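/- **Setting.** Let $\mathcal A\subseteq\mathbb R^{D_A}$, $\mathcal X\subseteq\mathbb R^{D_X}$ be measurable sets contained in balls of radius $B$. Let $(A,X,Y)$ be random variables with $A\in\mathcal A$, $X\in\mathcal X$, and let $Y^{(a)}\in[-R,R]$, $a\in\mathcal A$, be potential outcomes with $Y=Y^{(A)}$. Fix regular conditional probabilities given $A=a'$ and given $(A,X)=(a,x)$, defined at every $a,a'\in\mathcal A$, $x\in\mathcal X$, and let $X$ be a back-door variable: the conditional law of $Y^{(a)}$ given $A=a',X=x$ does not depend on $a'$. Put $g(a,x)=\mathbb E[Y\mid A=a,X=x]$, $\theta_{\mathrm{ATE}}(a)=\mathbb E[Y^{(a)}]$, $\theta_{\mathrm{ATT}}(a;a')=\mathbb E[Y^{(a)}\mid A=a']$, and $\|h\|_{P}=\sqrt{\mathbb E[h^2]}$. **First stage.** A norm-bounded ReLU network class $\mathcal H_{\mathrm{NN}}$ on $\mathbb R^D$ consists of the functions $s\mapsto W^{(L)}\sigma(W^{(L-1)}\sigma(\cdots\sigma(W^{(1)}s)))$ with scalar output, width $H$, $\sigma(t)=\max(0,t)$ and $\prod_{i}\|W^{(i)}\|_{p,q}\le\gamma$,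 where $\|W\|_{p,q}=\sup_{x\ne0}\|Wx\|_q/\|x\|_p$, $L\ge1$, $p,q\in[1,\infty]$. Features are vectors of truncated networks $\tilde\sigma\circ f$, $f\in\mathcal H_{\mathrm{NN}}$, $\tilde\sigma(t)=\min(1,\max(0,t))$. Let $\mathcal H_g$ be the set of functions $h(a,x)=w^\top(\phi_A(a)\otimes\phi_X(x))$ with $w\in\mathbb R^{d_1d_2}$, $\|w\|_1\le R$, and such features $\phi_A:\mathbb R^{D_A}\to\mathbb R^{d_1}$, $\phi_X:\mathbb R^{D_X}\to\mathbb R^{d_2}$. Assume that $g$ agrees on $\mathcal A\times\mathcal X$ with an element of $\mathcal H_g$ and that, for some $c,\beta>0$ and all $h_1,h_2\in\mathcal H_g$, $$\sup_{a\in\mathcal A,x\in\mathcal X}|h_1(a,x)-h_2(a,x)|\le\tfrac1c\,\|h_1(A,X)-h_2(A,X)\|_{P}^{1/\beta}.$$ From an i.i.d. sample $(a_i,x_i,y_i)_{i\le n}$, let $(\hat w,\hat\phi_A,\hat\phi_X)$ be any minimizer of $\frac1n\sum_i(y_i-w^\top(\phi_A(a_i)\otimes\phi_X(x_i)))^2$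 over the parameters defining $\mathcal H_g$, and let $\hat\theta_{\mathrm{ATE}}(a)=\hat w^\top\big(\hat\phi_A(a)\otimes\frac1n\sum_i\hat\phi_X(x_i)\big)$. **Theorem.** Let $\delta>0$. (i) There is a constant $C$, depending only on the parameters $D_A,D_X,d_1,d_2,L,H,p,q,\gamma,R,B,c,\beta,\delta$, such that for every $n\ge1$, with probability at least $1-4\delta$, $$\sup_{a\in\mathcal A}|\theta_{\mathrm{ATE}}(a)-\hat\theta_{\mathrm{ATE}}(a)|\le C\,n^{-1/(4\beta)}.$$ (ii) Let in addition $\mathcal H_f$ be a set of measurable functions on $\mathbb R^{D_A}$ with values in $[-1,1]$ on $\mathcal A$ that either has empirical Rademacher complexity at most $K/\sqrt n$ on every sample of every size $n\ge 1$ from $\mathcal A$, or is contained in a norm-bounded ReLU network class (possibly with other hyperparameters) or in the class of the truncations $\tilde\sigma\circ f$ of its members. Suppose that, for some $c',\beta'>0$ and all $f,\tilde f\in\mathcal H_f^{d_2}$, $$\sup_{a\in\mathcal A}\|f(a)-\tilde f(a)\|_\infty\le\tfrac1{c'}\Big(\max_{j}\|f_j(A)-\tilde f_j(A)\|_{P}\Big)^{1/\beta'}.$$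 Let $\hat f$ be any minimizer of $\frac1n\sum_i\|\hat\phi_X(x_i)-f(a_i)\|_2^2$ over $f\in\mathcal H_f^{d_2}$ and let $\hat\theta_{\mathrm{ATT}}(a;a')=\hat w^\top(\hat\phi_A(a)\otimes\hat f(a'))$. Then there is a constant $C$, depending only on the parameters in (i), $c',\beta'$, and $K$ or the hyperparameters of the second class, such that for every $n\ge1$, with probability at least $1-4\delta$: if $a\mapsto\mathbb E[\hat\phi_X(X)\mid A=a]$ agrees on $\mathcal A$ with an element of $\mathcal H_f^{d_2}$, then $$\sup_{a,a'\in\mathcal A}|\theta_{\mathrm{ATT}}(a;a')-\hat\theta_{\mathrm{ATT}}(a;a')|\le C\big(n^{-1/(4\beta)}+n^{-1/(4\beta')}\big).$$ -/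

import Mathlib

open MeasureTheory ProbabilityTheory
open scoped ENNReal

universe u

noncomputable section

/-! ### ReLU networks and feature maps -/

/-- The operator norm `‖W‖_{p,q} = sup_{x ≠ 0} ‖W x‖_q / ‖x‖_p`
(the term at `x = 0` is `0 / 0 = 0` and does not change the supremum). -/
def matrixNorm (p q : ℝ≥0∞) {m k : ℕ} (W : Matrix (Fin m) (Fin k) ℝ) : ℝ :=
  ⨆ x : Fin k → ℝ, ‖WithLp.toLp q (W.mulVec x)‖ / ‖WithLp.toLp p x‖

/-- Weights of a scalar-valued feed-forward network of width `H`, without biases: `ReLUNet H k L`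
has input dimension `k` and `L ≥ 1` layers. -/
inductive ReLUNet (H : ℕ) : ℕ → ℕ → Type
  | last {k : ℕ} (W : Matrix (Fin 1) (Fin k) ℝ) : ReLUNet H k 1
  | cons {k L : ℕ} (W : Matrix (Fin H) (Fin k) ℝ) (N : ReLUNet H H L) : ReLUNet H k (L + 1)

/-- `f(s) = W⁽ᴸ⁾ σ(W⁽ᴸ⁻¹⁾ σ(⋯ σ(W⁽¹⁾ s)))` with `σ(t) = max 0 t` coordinatewise. -/
def ReLUNet.eval {H : ℕ} : {k L : ℕ} → ReLUNet H k L → (Fin k → ℝ) → ℝ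
  | _, _, .last W, s => W.mulVec s 0
  | _, _, .cons W N, s => N.eval (fun i => max 0 (W.mulVec s i))

/-- `∏ᵢ ‖W⁽ⁱ⁾‖_{p,q}`. -/
def ReLUNet.normProd (p q : ℝ≥0∞) {H : ℕ} : {k L : ℕ} → ReLUNet H k L → ℝ
  | _, _, .last W => matrixNorm p q W
  | _, _, .cons W N => matrixNorm p q W * N.normProd p q

/-- Hyperparameters of a norm-bounded network class: depth, width, the exponents of the weight
norms, and the bound `γ` on the product of the weight norms. -/
structure NetParams where
  L : ℕ
  H : ℕ
  p : ℝ≥0∞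
  q : ℝ≥0∞
  γ : ℝ
  one_le_L : 1 ≤ L
  one_le_p : 1 ≤ p
  one_le_q : 1 ≤ q

/-- The class of norm-bounded ReLU networks on `ℝ^D`. -/
def netClass (N : NetParams) (D : ℕ) : Set ((Fin D → ℝ) → ℝ) :=
  {f | ∃ net : ReLUNet N.H D N.L, net.normProd N.p N.q ≤ N.γ ∧ f = net.eval}

/-- The ramp function `t ↦ min(1, max(0, t))`. -/
def ramp (t : ℝ) : ℝ := min 1 (max 0 t)

/-- Ramp-truncated networks. -/
def rampNetClass (N : NetParams) (D : ℕ) : Set ((Fin D → ℝ) → ℝ) :=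
  {f | ∃ f₀ ∈ netClass N D, f = fun s => ramp (f₀ s)}

/-- Feature maps `ℝ^D → ℝ^d` all of whose coordinates are ramp-truncated networks. -/
def featureClass (N : NetParams) (D d : ℕ) : Set ((Fin D → ℝ) → Fin d → ℝ) :=
  {φ | ∀ j, (fun s => φ s j) ∈ rampNetClass N D}

/-! ### The first-stage hypothesis class -/

/-- `wᵀ (u ⊗ v)`. -/
def tensorForm {d₁ d₂ : ℕ} (w : Fin d₁ → Fin d₂ → ℝ) (u : Fin d₁ → ℝ) (v : Fin d₂ → ℝ) : ℝ :=
  ∑ i, ∑ j, w i j * (u i * v j)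

/-- A triple `(w, φ_A, φ_X)` of a weight vector and two feature maps. -/
structure FirstStage (DA DX d₁ d₂ : ℕ) where
  w : Fin d₁ → Fin d₂ → ℝ
  φA : (Fin DA → ℝ) → Fin d₁ → ℝ
  φX : (Fin DX → ℝ) → Fin d₂ → ℝ

/-- The regression function `(a, x) ↦ wᵀ (φ_A(a) ⊗ φ_X(x))`. -/
def FirstStage.fn {DA DX d₁ d₂ : ℕ} (h : FirstStage DA DX d₁ d₂)
    (a : Fin DA → ℝ) (x : Fin DX → ℝ) : ℝ :=
  tensorForm h.w (h.φA a) (h.φX x)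

/-- The first-stage hypothesis class `ℋ_g`, as a set of triples: `‖w‖₁ ≤ R` and features given by
ramp-truncated norm-bounded ReLU networks. -/
def firstStageClass (N : NetParams) (R : ℝ) (DA DX d₁ d₂ : ℕ) : Set (FirstStage DA DX d₁ d₂) :=
  {h | ∑ i, ∑ j, |h.w i j| ≤ R ∧ h.φA ∈ featureClass N DA d₁ ∧ h.φX ∈ featureClass N DX d₂}

/-! ### The causal model -/

/-- Treatment `A ∈ 𝒜 ⊆ ℝ^DA`, back-door variable `X ∈ 𝒳 ⊆ ℝ^DX`, outcome `Y` and potential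
outcomes `Y⁽ᵃ⁾ ∈ [-R, R]`.  Since the target parameters are conditional expectations at every single
point `(a, x)` and `a'`, the model comes with regular conditional probabilities: `condX a'` is the
law of `X` given `A = a'`, and `condΩ (a, x)` is the probability on `Ω` given `A = a, X = x`. -/
structure BackdoorModel (Ω : Type*) [MeasurableSpace Ω] (DA DX : ℕ) (R : ℝ) where
  μ : Measure Ω
  isProb : IsProbabilityMeasure μ
  𝒜 : Set (Fin DA → ℝ)
  𝒳 : Set (Fin DX → ℝ)
  measurableSet_𝒜 : MeasurableSet 𝒜
  measurableSet_𝒳 : MeasurableSet 𝒳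
  A : Ω → Fin DA → ℝ
  X : Ω → Fin DX → ℝ
  Y : Ω → ℝ
  measurable_A : Measurable A
  measurable_X : Measurable X
  measurable_Y : Measurable Y
  A_mem : ∀ ω, A ω ∈ 𝒜
  X_mem : ∀ ω, X ω ∈ 𝒳
  /-- The potential outcome `Y⁽ᵃ⁾`. -/
  Ypot : (Fin DA → ℝ) → Ω → ℝ
  measurable_Ypot : ∀ a ∈ 𝒜, Measurable (Ypot a)
  Ypot_bound : ∀ a ∈ 𝒜, ∀ ω, |Ypot a ω| ≤ R
  /-- No interference: the observed outcome is `Y⁽ᵃ⁾` when `A = a`. -/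
  consistency : ∀ ω, Y ω = Ypot (A ω) ω
  /-- Regular conditional law of `X` given `A`. -/
  condX : Kernel (Fin DA → ℝ) (Fin DX → ℝ)
  isMarkov_condX : IsMarkovKernel condX
  condX_mem : ∀ a ∈ 𝒜, ∀ᵐ x ∂(condX a), x ∈ 𝒳
  condX_spec : (μ.map A).compProd condX = μ.map (fun ω => (A ω, X ω))
  /-- Regular conditional probability on `Ω` given `(A, X)`. -/
  condΩ : Kernel ((Fin DA → ℝ) × (Fin DX → ℝ)) Ω
  isMarkov_condΩ : IsMarkovKernel condΩ
  condΩ_fiber : ∀ a ∈ 𝒜, ∀ x ∈ 𝒳, ∀ᵐ ω ∂(condΩ (a, x)), A ω = a ∧ X ω = x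
  condΩ_spec : (μ.map (fun ω => (A ω, X ω))).bind condΩ = μ
  /-- `X` is a back-door variable, `Y⁽ᵃ⁾ ⫫ A ∣ X`: the conditional law of `Y⁽ᵃ⁾` given
  `A = a', X = x` does not depend on `a'`. -/
  exchangeable : ∀ a ∈ 𝒜, ∀ a' ∈ 𝒜, ∀ x ∈ 𝒳,
    (condΩ (a', x)).map (Ypot a) = (condΩ (a, x)).map (Ypot a)

namespace BackdoorModel

variable {Ω : Type*} [MeasurableSpace Ω] {DA DX : ℕ} {R : ℝ} (M : BackdoorModel Ω DA DX R)

/-- The regression function `g(a, x) = E[Y ∣ A = a, X = x]`. -/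
def g (a : Fin DA → ℝ) (x : Fin DX → ℝ) : ℝ := ∫ ω, M.Y ω ∂(M.condΩ (a, x))

/-- The conditional probability on `Ω` given `A = a'`. -/
def condGivenA (a' : Fin DA → ℝ) : Measure Ω := (M.condX a').bind (fun x => M.condΩ (a', x))

/-- `θ_ATE(a) = E[Y⁽ᵃ⁾]`. -/
def ate (a : Fin DA → ℝ) : ℝ := ∫ ω, M.Ypot a ω ∂M.μ

/-- `θ_ATT(a; a') = E[Y⁽ᵃ⁾ ∣ A = a']`. -/
def att (a a' : Fin DA → ℝ) : ℝ := ∫ ω, M.Ypot a ω ∂(M.condGivenA a')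

/-- The joint law `P` of one observation `(A, X, Y)`. -/
def law : Measure ((Fin DA → ℝ) × (Fin DX → ℝ) × ℝ) := M.μ.map (fun ω => (M.A ω, M.X ω, M.Y ω))

/-- The law of an i.i.d. sample of size `n`. -/
def sampleLaw (n : ℕ) : Measure (Fin n → (Fin DA → ℝ) × (Fin DX → ℝ) × ℝ) :=
  Measure.pi (fun _ => M.law)

/-- `‖h(A, X)‖_{P(A,X)}`, the `L²`-norm. -/
def l2AX (h : (Fin DA → ℝ) → (Fin DX → ℝ) → ℝ) : ℝ := √(∫ ω, (h (M.A ω) (M.X ω)) ^ 2 ∂M.μ)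

/-- `‖f(A)‖_{P(A)}`, the `L²`-norm. -/
def l2A (f : (Fin DA → ℝ) → ℝ) : ℝ := √(∫ ω, (f (M.A ω)) ^ 2 ∂M.μ)

/-- Both input domains lie in a ball of radius `B`. -/
def InputsBounded (B : ℝ) : Prop := (∀ a ∈ M.𝒜, ‖a‖ ≤ B) ∧ (∀ x ∈ M.𝒳, ‖x‖ ≤ B)

/-- The true regression function belongs to the first-stage class. -/
def WellSpecified (N : NetParams) (d₁ d₂ : ℕ) : Prop :=
  ∃ h ∈ firstStageClass N R DA DX d₁ d₂, ∀ a ∈ M.𝒜, ∀ x ∈ M.𝒳, h.fn a x = M.g a x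

/-- `sup_{a,x} |h₁ - h₂| ≤ c⁻¹ ‖h₁(A,X) - h₂(A,X)‖^{1/β}` on the first-stage class. -/
def SupNormCondition (N : NetParams) (d₁ d₂ : ℕ) (c β : ℝ) : Prop :=
  ∀ h₁ ∈ firstStageClass N R DA DX d₁ d₂, ∀ h₂ ∈ firstStageClass N R DA DX d₁ d₂,
    ∀ a ∈ M.𝒜, ∀ x ∈ M.𝒳,
      |h₁.fn a x - h₂.fn a x| ≤ 1 / c * (M.l2AX (fun a x => h₁.fn a x - h₂.fn a x)) ^ (1 / β)

/-- `sup_a ‖f(a) - f̃(a)‖_∞ ≤ c'⁻¹ (max_j ‖f_j(A) - f̃_j(A)‖)^{1/β'}` on the second-stage class,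
which consists of the vector functions all of whose `d₂` coordinates lie in `Hf`. -/
def SupNormCondition₂ (Hf : Set ((Fin DA → ℝ) → ℝ)) (d₂ : ℕ) (c' β' : ℝ) : Prop :=
  ∀ f f' : Fin d₂ → (Fin DA → ℝ) → ℝ, (∀ j, f j ∈ Hf) → (∀ j, f' j ∈ Hf) →
    ∀ a ∈ M.𝒜, ∀ i,
      |f i a - f' i a| ≤ 1 / c' * (⨆ j, M.l2A (fun a => f j a - f' j a)) ^ (1 / β')

/-- The second-stage scalar class consists of measurable functions with values in `[-1, 1]`
on `𝒜`. -/
def IsSecondStageClass (Hf : Set ((Fin DA → ℝ) → ℝ)) : Prop :=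
  ∀ f ∈ Hf, Measurable f ∧ ∀ a ∈ M.𝒜, |f a| ≤ 1

end BackdoorModel

/-! ### Empirical Rademacher complexity -/

/-- `E_σ [ sup_{h ∈ 𝓗} (1/n) ∑ᵢ σᵢ h(sᵢ) ]` with independent uniform signs `σᵢ ∈ {-1, 1}`. -/
def empRademacher {Z : Type*} (𝓗 : Set (Z → ℝ)) {n : ℕ} (s : Fin n → Z) : ℝ :=
  1 / 2 ^ n * ∑ σ : Fin n → ℤˣ, ⨆ h : 𝓗, 1 / (n : ℝ) * ∑ i, ((σ i : ℤ) : ℝ) * h.1 (s i)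

/-- The empirical Rademacher complexity on samples from `𝒵` is at most `K / √n`. -/
def HasRademacherRate {Z : Type*} (𝓗 : Set (Z → ℝ)) (𝒵 : Set Z) (K : ℝ) : Prop :=
  ∀ n : ℕ, 1 ≤ n → ∀ s : Fin n → Z, (∀ i, s i ∈ 𝒵) → empRademacher 𝓗 s ≤ K / √n

/-! ### The estimators -/

section Estimators

variable {DA DX d₁ d₂ n : ℕ}

/-- First-stage empirical loss; the sample is `S i = (aᵢ, xᵢ, yᵢ)`. -/
def loss₁ (S : Fin n → (Fin DA → ℝ) × (Fin DX → ℝ) × ℝ) (h : FirstStage DA DX d₁ d₂) : ℝ :=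
  1 / (n : ℝ) * ∑ i, ((S i).2.2 - h.fn (S i).1 (S i).2.1) ^ 2

/-- `h` is an empirical risk minimizer of the first stage. -/
def IsERM₁ (N : NetParams) (R : ℝ) (S : Fin n → (Fin DA → ℝ) × (Fin DX → ℝ) × ℝ)
    (h : FirstStage DA DX d₁ d₂) : Prop :=
  h ∈ firstStageClass N R DA DX d₁ d₂ ∧
    ∀ h' ∈ firstStageClass N R DA DX d₁ d₂, loss₁ S h ≤ loss₁ S h'

/-- Second-stage empirical loss `(1/n) ∑ᵢ ‖φ_X(xᵢ) - f(aᵢ)‖²` (Euclidean norm). -/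
def loss₂ (S : Fin n → (Fin DA → ℝ) × (Fin DX → ℝ) × ℝ) (φX : (Fin DX → ℝ) → Fin d₂ → ℝ)
    (f : Fin d₂ → (Fin DA → ℝ) → ℝ) : ℝ :=
  1 / (n : ℝ) * ∑ i, ∑ j, (φX (S i).2.1 j - f j (S i).1) ^ 2

/-- `f` is an empirical risk minimizer of the second stage for the feature map `φX`. -/
def IsERM₂ (Hf : Set ((Fin DA → ℝ) → ℝ)) (S : Fin n → (Fin DA → ℝ) × (Fin DX → ℝ) × ℝ)
    (φX : (Fin DX → ℝ) → Fin d₂ → ℝ) (f : Fin d₂ → (Fin DA → ℝ) → ℝ) : Prop :=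
  (∀ j, f j ∈ Hf) ∧
    ∀ f' : Fin d₂ → (Fin DA → ℝ) → ℝ, (∀ j, f' j ∈ Hf) → loss₂ S φX f ≤ loss₂ S φX f'

/-- `θ̂_ATE(a) = wᵀ (φ_A(a) ⊗ (1/n) ∑ᵢ φ_X(xᵢ))`. -/
def ateHat (S : Fin n → (Fin DA → ℝ) × (Fin DX → ℝ) × ℝ) (h : FirstStage DA DX d₁ d₂)
    (a : Fin DA → ℝ) : ℝ :=
  tensorForm h.w (h.φA a) (fun j => 1 / (n : ℝ) * ∑ i, h.φX (S i).2.1 j)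

/-- `θ̂_ATT(a; a') = wᵀ (φ_A(a) ⊗ f(a'))`. -/
def attHat (h : FirstStage DA DX d₁ d₂) (f : Fin d₂ → (Fin DA → ℝ) → ℝ)
    (a a' : Fin DA → ℝ) : ℝ :=
  tensorForm h.w (h.φA a) (fun j => f j a')

end Estimators

namespace BackdoorModel

variable {Ω : Type*} [MeasurableSpace Ω] {DA DX : ℕ} {R : ℝ} (M : BackdoorModel Ω DA DX R)

/-- The conditional mean embedding `a ↦ E[φ(X) ∣ A = a]` belongs to the second-stage class. -/
def WellSpecified₂ (Hf : Set ((Fin DA → ℝ) → ℝ)) {d₂ : ℕ}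
    (φ : (Fin DX → ℝ) → Fin d₂ → ℝ) : Prop :=
  ∃ f : Fin d₂ → (Fin DA → ℝ) → ℝ, (∀ j, f j ∈ Hf) ∧
    ∀ a ∈ M.𝒜, ∀ j, f j a = ∫ x, φ x j ∂(M.condX a)

/-- With probability at least `1 - 4δ` over an i.i.d. sample of size `n`, every first-stage
minimizer satisfies `sup_a |θ_ATE(a) - θ̂_ATE(a)| ≤ ε`. -/
def ATEBound (N : NetParams) (d₁ d₂ n : ℕ) (δ ε : ℝ) : Prop :=
  ∃ E : Set (Fin n → (Fin DA → ℝ) × (Fin DX → ℝ) × ℝ), MeasurableSet E ∧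
    ENNReal.ofReal (1 - 4 * δ) ≤ M.sampleLaw n E ∧
    ∀ S ∈ E, ∀ h : FirstStage DA DX d₁ d₂, IsERM₁ N R S h →
      ∀ a ∈ M.𝒜, |M.ate a - ateHat S h a| ≤ ε

/-- With probability at least `1 - 4δ` over an i.i.d. sample of size `n`, whenever the conditional
mean embedding of the learned feature map is in the second-stage class, all minimizers of the two
stages satisfy `sup_{a,a'} |θ_ATT(a; a') - θ̂_ATT(a; a')| ≤ ε`. -/
def ATTBound (N : NetParams) (Hf : Set ((Fin DA → ℝ) → ℝ)) (d₁ d₂ n : ℕ) (δ ε : ℝ) : Prop :=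
  ∃ E : Set (Fin n → (Fin DA → ℝ) × (Fin DX → ℝ) × ℝ), MeasurableSet E ∧
    ENNReal.ofReal (1 - 4 * δ) ≤ M.sampleLaw n E ∧
    ∀ S ∈ E, ∀ h : FirstStage DA DX d₁ d₂, IsERM₁ N R S h → M.WellSpecified₂ Hf h.φX →
      ∀ f : Fin d₂ → (Fin DA → ℝ) → ℝ, IsERM₂ Hf S h.φX f →
        ∀ a ∈ M.𝒜, ∀ a' ∈ M.𝒜, |M.att a a' - attHat h f a a'| ≤ ε

end BackdoorModel

end

/-! Exchangeability and consistency give the back-door formulas: `ate` averages `g(a, ·)` over the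
law of `X`, and `att` averages it over the law of `X` given `A = a'` (`ate_eq`, `att_eq`). It
remains to estimate `g` and these averages uniformly.

For least squares with a well-specified target, the excess risk is the squared `L²`-distance to the
target (`integral_excess_first`, `integral_excess_second`), and a minimizer has nonpositive
empirical excess risk. The squared `L²`-error is therefore at most the one-sided deviation between
population and empirical excess risk, uniformly over the class. Symmetrization and Markov's
inequality bound this deviation by a multiple of `n^{-1/2}` (`exists_uniform_deviation_event`). Thus
the `L²`-error is of order `n^{-1/4}`, and the sup-norm conditions turn it into `n^{-1/(4β)}` or
`n^{-1/(4β')}`.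

The complexity input is a Rademacher bound of order `√n` for unnormalized sums. For networks it
follows by peeling off layers (`ReLUNet.exists_rademacherAbsLE`); truncation, products of features
and squared losses are handled by the contraction principle.

For ATE, the fixed features of the true `h₀` serve as intermediate point, so only finitely many
means must concentrate. For ATT, the second-stage event is uniform over all feature maps, because
the learned one depends on the same sample. Measurability of the events is secured by countable
subfamilies dense in the sup norm (`SepOn`). -/

/-! ### Rademacher averages and the contraction principle. -/

/-- The sign `σ i ∈ {-1, 1}` as a real number. -/
abbrev sgn {n : ℕ} (σ : Fin n → ℤˣ) (i : Fin n) : ℝ := ((σ i : ℤ) : ℝ)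

/-- `E_σ [ sup_k ∑ᵢ σᵢ t k i ] ≤ K`, phrased through a majorant of the supremum. -/
def RademacherLE {ι : Type*} {n : ℕ} (t : ι → Fin n → ℝ) (K : ℝ) : Prop :=
  ∃ b : (Fin n → ℤˣ) → ℝ, (∀ σ k, ∑ i, sgn σ i * t k i ≤ b σ) ∧ ∑ σ, b σ ≤ 2 ^ n * K

/-- `E_σ [ sup_k |∑ᵢ σᵢ t k i| ] ≤ K`, phrased through a nonnegative majorant of the supremum. -/
def RademacherAbsLE {ι : Type*} {n : ℕ} (t : ι → Fin n → ℝ) (K : ℝ) : Prop :=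
  ∃ b : (Fin n → ℤˣ) → ℝ, (∀ σ, 0 ≤ b σ) ∧ (∀ σ k, |∑ i, sgn σ i * t k i| ≤ b σ) ∧
    ∑ σ, b σ ≤ 2 ^ n * K

section Rademacher

variable {ι κ : Type*} {n : ℕ}

/-- Flipping the `i`-th sign. -/
def flipSign (i : Fin n) : (Fin n → ℤˣ) ≃ (Fin n → ℤˣ) := Equiv.mulLeft (Pi.mulSingle i (-1))

lemma flipSign_same (i : Fin n) (σ : Fin n → ℤˣ) : sgn (flipSign i σ) i = -sgn σ i := by
  simp [flipSign, sgn]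

lemma flipSign_of_ne {i j : Fin n} (h : j ≠ i) (σ : Fin n → ℤˣ) :
    sgn (flipSign i σ) j = sgn σ j := by
  simp [flipSign, sgn, h]

lemma abs_sgn (σ : Fin n → ℤˣ) (i : Fin n) : |sgn σ i| = 1 := by
  rcases Int.units_eq_one_or (σ i) with h | h <;> simp [sgn, h]

lemma sgn_mul_self (σ : Fin n → ℤˣ) (i : Fin n) : sgn σ i * sgn σ i = 1 := by
  rcases Int.units_eq_one_or (σ i) with h | h <;> simp [sgn, h]

lemma card_signs : Fintype.card (Fin n → ℤˣ) = 2 ^ n := by simp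

lemma RademacherLE.mono {t : ι → Fin n → ℝ} {K K' : ℝ} (h : RademacherLE t K) (hK : K ≤ K') :
    RademacherLE t K' := by
  obtain ⟨b, hb, hs⟩ := h
  exact ⟨b, hb, hs.trans (by gcongr)⟩

lemma RademacherLE.reindex {t : ι → Fin n → ℝ} {K : ℝ} (h : RademacherLE t K) (e : κ → ι) :
    RademacherLE (fun k => t (e k)) K := by
  obtain ⟨b, hb, hs⟩ := h
  exact ⟨b, fun σ k => hb σ (e k), hs⟩

lemma RademacherLE.add {t u : ι → Fin n → ℝ} {K K' : ℝ} (h : RademacherLE t K)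
    (h' : RademacherLE u K') : RademacherLE (fun k i => t k i + u k i) (K + K') := by
  obtain ⟨b, hb, hs⟩ := h
  obtain ⟨b', hb', hs'⟩ := h'
  refine ⟨fun σ => b σ + b' σ, fun σ k => ?_, ?_⟩
  · simp only [mul_add, Finset.sum_add_distrib]
    exact add_le_add (hb σ k) (hb' σ k)
  · rw [Finset.sum_add_distrib, mul_add]
    exact add_le_add hs hs'

lemma RademacherLE.const_mul {t : ι → Fin n → ℝ} {K : ℝ} (h : RademacherLE t K) {c : ℝ}
    (hc : 0 ≤ c) : RademacherLE (fun k i => c * t k i) (c * K) := by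
  obtain ⟨b, hb, hs⟩ := h
  refine ⟨fun σ => c * b σ, fun σ k => ?_, ?_⟩
  · simp only [mul_left_comm _ c, ← Finset.mul_sum]
    exact mul_le_mul_of_nonneg_left (hb σ k) hc
  · rw [← Finset.mul_sum, mul_left_comm]
    exact mul_le_mul_of_nonneg_left hs hc

lemma RademacherLE.neg {t : ι → Fin n → ℝ} {K : ℝ} (h : RademacherLE t K) :
    RademacherLE (fun k i => -t k i) K := by
  obtain ⟨b, hb, hs⟩ := h
  refine ⟨fun σ => b (-σ), fun σ k => ?_, ?_⟩
  · refine le_trans (le_of_eq ?_) (hb (-σ) k)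
    exact Finset.sum_congr rfl fun i _ => by simp [sgn]
  · exact (Equiv.sum_comp (Equiv.neg (Fin n → ℤˣ)) b).trans_le hs

lemma ciSup_add_ciSup_le_of_forall [Nonempty ι] {f g : ι → ℝ} {c : ℝ}
    (h : ∀ k l, f k + g l ≤ c) : (⨆ k, f k) + (⨆ l, g l) ≤ c := by
  have h1 : ∀ l, (⨆ k, f k) ≤ c - g l := fun l => ciSup_le fun k => by linarith [h k l]
  have h2 : (⨆ l, g l) ≤ c - ⨆ k, f k := ciSup_le fun l => by linarith [h1 l]
  linarith

/-- Replacing one coordinate by one with smaller increments. -/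
lemma RademacherLE.compare_one {t u : ι → Fin n → ℝ} {K : ℝ} (h : RademacherLE t K) (i : Fin n)
    (hi : ∀ k l, |u k i - u l i| ≤ |t k i - t l i|) (hne : ∀ j, j ≠ i → ∀ k, u k j = t k j) :
    RademacherLE u K := by
  rcases isEmpty_or_nonempty ι with hι | hι
  · obtain ⟨b, -, hs⟩ := h
    exact ⟨b, fun _ k => (hι.false k).elim, hs⟩
  obtain ⟨b, hb, hs⟩ := h
  -- Pair `σ` with its flip at `i`. The two `i`-th terms combine to `±(u k i - u l i)`, at most `|t
  -- k i - t l i|`. That absolute value is the combination for `t` with `k` and `l` in one of the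
  -- two orders, hence the four bounds below.
  have key : ∀ σ k l, (∑ j, sgn σ j * u k j) + ∑ j, sgn (flipSign i σ) j * u l j ≤
      b σ + b (flipSign i σ) := by
    intro σ k l
    have e1 : ∀ τ (v : ι → Fin n → ℝ) k, ∑ j, sgn τ j * v k j =
        sgn τ i * v k i + ∑ j ∈ Finset.univ.erase i, sgn τ j * v k j := fun τ v k =>
      (Finset.add_sum_erase _ _ (Finset.mem_univ i)).symm
    have e2 : ∀ τ k, ∑ j ∈ Finset.univ.erase i, sgn τ j * u k j =
        ∑ j ∈ Finset.univ.erase i, sgn τ j * t k j := fun τ k =>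
      Finset.sum_congr rfl fun j hj => by rw [hne j (Finset.ne_of_mem_erase hj)]
    have e3 : ∀ k, ∑ j ∈ Finset.univ.erase i, sgn (flipSign i σ) j * t k j =
        ∑ j ∈ Finset.univ.erase i, sgn σ j * t k j := fun k =>
      Finset.sum_congr rfl fun j hj => by rw [flipSign_of_ne (Finset.ne_of_mem_erase hj)]
    have b1 := hb σ k
    have b2 := hb σ l
    have b3 := hb (flipSign i σ) k
    have b4 := hb (flipSign i σ) l
    rw [e1, flipSign_same, e3] at b3 b4
    rw [e1] at b1 b2
    rw [e1, e1 _ u, e2, e2, flipSign_same, e3]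
    have h1 := (le_abs_self _).trans (hi k l)
    have h2 := (neg_le_abs _).trans (hi k l)
    rcases Int.units_eq_one_or (σ i) with hσ | hσ <;> simp only [sgn, hσ] at * <;>
      push_cast at * <;>
      rcases abs_cases (t k i - t l i) with ⟨h3, -⟩ | ⟨h3, -⟩ <;> linarith
  -- Fixing `l` in `key` bounds the new supremum, so no boundedness of `u` has to be assumed.
  have hbdd : ∀ σ, BddAbove (Set.range fun k => ∑ j, sgn σ j * u k j) := by
    intro σ
    obtain ⟨l⟩ := hι
    refine ⟨b σ + b (flipSign i σ) - ∑ j, sgn (flipSign i σ) j * u l j, ?_⟩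
    rintro _ ⟨k, rfl⟩
    linarith [key σ k l]
  refine ⟨fun σ => ⨆ k, ∑ j, sgn σ j * u k j, fun σ k => le_ciSup (hbdd σ) k, ?_⟩
  have h2 : ∀ f : (Fin n → ℤˣ) → ℝ, ∑ σ, f (flipSign i σ) = ∑ σ, f σ :=
    fun f => Equiv.sum_comp (flipSign i) f
  have h3 : ∑ σ, ((⨆ k, ∑ j, sgn σ j * u k j) + ⨆ k, ∑ j, sgn (flipSign i σ) j * u k j) ≤
      ∑ σ, (b σ + b (flipSign i σ)) :=
    Finset.sum_le_sum fun σ _ => ciSup_add_ciSup_le_of_forall (key σ)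
  rw [Finset.sum_add_distrib, Finset.sum_add_distrib, h2 b,
    h2 (fun σ => ⨆ k, ∑ j, sgn σ j * u k j)] at h3
  linarith

/-- Contraction principle: coordinatewise smaller increments give a smaller Rademacher average. -/
theorem RademacherLE.compare {t u : ι → Fin n → ℝ} {K : ℝ} (h : RademacherLE t K)
    (hu : ∀ i k l, |u k i - u l i| ≤ |t k i - t l i|) : RademacherLE u K := by
  classical
  have key : ∀ s : Finset (Fin n), RademacherLE (fun k i => if i ∈ s then u k i else t k i) K := by
    intro s
    induction s using Finset.induction_on with
    | empty => simpa using h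
    | insert a s ha ih =>
      refine ih.compare_one a (fun k l => ?_) fun j hj k => ?_
      · simpa [ha] using hu a k l
      · simp [hj]
  simpa using key Finset.univ

lemma RademacherAbsLE.toLE {t : ι → Fin n → ℝ} {K : ℝ} (h : RademacherAbsLE t K) :
    RademacherLE t K := by
  obtain ⟨b, -, hb, hs⟩ := h
  exact ⟨b, fun σ k => (le_abs_self _).trans (hb σ k), hs⟩

lemma RademacherAbsLE.mono {t : ι → Fin n → ℝ} {K K' : ℝ} (h : RademacherAbsLE t K)
    (hK : K ≤ K') : RademacherAbsLE t K' := by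
  obtain ⟨b, h0, hb, hs⟩ := h
  exact ⟨b, h0, hb, hs.trans (by gcongr)⟩

lemma RademacherAbsLE.reindex {t : ι → Fin n → ℝ} {K : ℝ} (h : RademacherAbsLE t K) (e : κ → ι) :
    RademacherAbsLE (fun k => t (e k)) K := by
  obtain ⟨b, h0, hb, hs⟩ := h
  exact ⟨b, h0, fun σ k => hb σ (e k), hs⟩

lemma RademacherAbsLE.add {t u : ι → Fin n → ℝ} {K K' : ℝ} (h : RademacherAbsLE t K)
    (h' : RademacherAbsLE u K') : RademacherAbsLE (fun k i => t k i + u k i) (K + K') := by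
  obtain ⟨b, h0, hb, hs⟩ := h
  obtain ⟨b', h0', hb', hs'⟩ := h'
  refine ⟨fun σ => b σ + b' σ, fun σ => add_nonneg (h0 σ) (h0' σ), fun σ k => ?_, ?_⟩
  · simp only [mul_add, Finset.sum_add_distrib]
    exact (abs_add_le _ _).trans (add_le_add (hb σ k) (hb' σ k))
  · rw [Finset.sum_add_distrib, mul_add]
    exact add_le_add hs hs'

lemma RademacherAbsLE.neg {t : ι → Fin n → ℝ} {K : ℝ} (h : RademacherAbsLE t K) :
    RademacherAbsLE (fun k i => -t k i) K := by
  obtain ⟨b, h0, hb, hs⟩ := h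
  refine ⟨b, h0, fun σ k => ?_, hs⟩
  simpa only [mul_neg, Finset.sum_neg_distrib, abs_neg] using hb σ k

/-- Linear combinations with `ℓ¹`-bounded coefficients. -/
lemma RademacherAbsLE.linear {α : Type*} [Fintype α] {t : ι × α → Fin n → ℝ} {K c : ℝ}
    (h : RademacherAbsLE t K) (w : κ → α → ℝ) (e : κ → ι) (hc : 0 ≤ c)
    (hw : ∀ k, ∑ j, |w k j| ≤ c) :
    RademacherAbsLE (fun k i => ∑ j, w k j * t (e k, j) i) (c * K) := by
  obtain ⟨b, h0, hb, hs⟩ := h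
  refine ⟨fun σ => c * b σ, fun σ => mul_nonneg hc (h0 σ), fun σ k => ?_, ?_⟩
  · have e1 : ∑ i, sgn σ i * ∑ j, w k j * t (e k, j) i =
        ∑ j, w k j * ∑ i, sgn σ i * t (e k, j) i := by
      simp only [Finset.mul_sum]
      rw [Finset.sum_comm]
      exact Finset.sum_congr rfl fun j _ => Finset.sum_congr rfl fun i _ => by ring
    rw [e1]
    calc |∑ j, w k j * ∑ i, sgn σ i * t (e k, j) i|
        ≤ ∑ j, |w k j * ∑ i, sgn σ i * t (e k, j) i| := Finset.abs_sum_le_sum_abs _ _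
      _ ≤ ∑ j, |w k j| * b σ := Finset.sum_le_sum fun j _ => by
          rw [abs_mul]
          exact mul_le_mul_of_nonneg_left (hb σ _) (abs_nonneg _)
      _ ≤ c * b σ := by
          rw [← Finset.sum_mul]
          exact mul_le_mul_of_nonneg_right (hw k) (h0 σ)
  · rw [← Finset.mul_sum, mul_left_comm]
    exact mul_le_mul_of_nonneg_left hs hc

/-- Contraction principle with absolute values, for contractions fixing zero. -/
theorem RademacherAbsLE.compare {t u : ι → Fin n → ℝ} {K : ℝ} (h : RademacherAbsLE t K)
    (hu : ∀ i k l, |u k i - u l i| ≤ |t k i - t l i|) (hu0 : ∀ i k, |u k i| ≤ |t k i|) :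
    RademacherAbsLE u (2 * K) := by
  obtain ⟨b, h0, hb, hs⟩ := h
  -- Adjoining the zero vector as index `none` forces one-sided majorants to be nonnegative. The
  -- majorants for `u` and `-u` can then be added to control the absolute value, whence the factor
  -- `2`.
  have h1 : RademacherLE (fun (k : Option ι) i => k.elim 0 fun k => t k i) K := by
    refine ⟨b, fun σ k => ?_, hs⟩
    cases k with
    | none => simpa using h0 σ
    | some k => exact (le_abs_self _).trans (hb σ k)
  have h2 : RademacherLE (fun (k : Option ι) i => k.elim 0 fun k => u k i) K := by
    refine h1.compare fun i k l => ?_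
    cases k <;> cases l <;> simp [hu, hu0]
  obtain ⟨b₁, hb₁, hs₁⟩ := h2
  obtain ⟨b₂, hb₂, hs₂⟩ := RademacherLE.neg ⟨b₁, hb₁, hs₁⟩
  have p₁ : ∀ σ, 0 ≤ b₁ σ := fun σ => by simpa using hb₁ σ none
  have p₂ : ∀ σ, 0 ≤ b₂ σ := fun σ => by simpa using hb₂ σ none
  refine ⟨fun σ => b₁ σ + b₂ σ, fun σ => add_nonneg (p₁ σ) (p₂ σ), fun σ k => ?_, ?_⟩
  · have q₁ := hb₁ σ (some k)
    have q₂ := hb₂ σ (some k)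
    simp only [Option.elim_some, mul_neg, Finset.sum_neg_distrib] at q₁ q₂
    exact abs_le.2 ⟨by linarith [p₁ σ], by linarith [p₂ σ]⟩
  · rw [Finset.sum_add_distrib]
    linarith

/-- Flipping one of two distinct signs negates the sum. This orthogonality computes the second
moment of a signed sum. -/
lemma sum_sgn_mul_sgn (i j : Fin n) :
    ∑ σ : Fin n → ℤˣ, sgn σ i * sgn σ j = if i = j then 2 ^ n else 0 := by
  split_ifs with h
  · subst h
    simp [sgn_mul_self]
  · have h1 := Equiv.sum_comp (flipSign i) fun σ => sgn σ i * sgn σ j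
    simp only [flipSign_same, flipSign_of_ne (Ne.symm h), neg_mul, Finset.sum_neg_distrib] at h1
    linarith

/-- `E_σ |∑ᵢ σᵢ tᵢ| ≤ (∑ᵢ tᵢ²)^{1/2}`. -/
lemma sum_abs_sum_sgn_mul_le (t : Fin n → ℝ) :
    ∑ σ, |∑ i, sgn σ i * t i| ≤ 2 ^ n * √(∑ i, t i ^ 2) := by
  have h1 : ∑ σ : Fin n → ℤˣ, |∑ i, sgn σ i * t i| ^ 2 = 2 ^ n * ∑ i, t i ^ 2 := by
    have : ∀ σ : Fin n → ℤˣ, |∑ i, sgn σ i * t i| ^ 2 =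
        ∑ i, ∑ j, t i * t j * (sgn σ i * sgn σ j) := fun σ => by
      rw [sq_abs, sq, Finset.sum_mul_sum]
      exact Finset.sum_congr rfl fun i _ => Finset.sum_congr rfl fun j _ => by ring
    simp only [this]
    rw [Finset.sum_comm]
    simp_rw [Finset.sum_comm (s := (Finset.univ : Finset (Fin n → ℤˣ))), ← Finset.mul_sum,
      sum_sgn_mul_sgn]
    simp [Finset.mul_sum]
    exact Finset.sum_congr rfl fun i _ => by ring
  -- Cauchy–Schwarz over the `2 ^ n` sign vectors passes from the second moment to the first.
  have h2 := sq_sum_le_card_mul_sum_sq (s := (Finset.univ : Finset (Fin n → ℤˣ)))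
    (f := fun σ => |∑ i, sgn σ i * t i|)
  rw [h1, Finset.card_univ, card_signs] at h2
  refine abs_le_of_sq_le_sq' ?_ (by positivity) |>.2
  rw [mul_pow, Real.sq_sqrt (Finset.sum_nonneg fun _ _ => sq_nonneg _)]
  push_cast at h2
  linarith

/-- A finite family of vectors bounded by `B`. -/
lemma RademacherAbsLE.of_finite {α : Type*} [Fintype α] {B : ℝ} (hB : 0 ≤ B)
    (t : α → Fin n → ℝ) (ht : ∀ j i, |t j i| ≤ B) :
    RademacherAbsLE t (Fintype.card α * B * √n) := by
  -- The maximum over the family is majorized by the sum; this costs the factor `Fintype.card α`,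
  -- which does not involve `n`.
  refine ⟨fun σ => ∑ j, |∑ i, sgn σ i * t j i|, fun σ => Finset.sum_nonneg fun _ _ => abs_nonneg _,
    fun σ k => Finset.single_le_sum (f := fun j => |∑ i, sgn σ i * t j i|)
      (fun _ _ => abs_nonneg _) (Finset.mem_univ k), ?_⟩
  rw [Finset.sum_comm]
  have h1 : ∀ j, ∑ σ, |∑ i, sgn σ i * t j i| ≤ 2 ^ n * (B * √n) := fun j => by
    refine (sum_abs_sum_sgn_mul_le (t j)).trans ?_
    gcongr
    rw [← Real.sqrt_sq hB, ← Real.sqrt_mul (sq_nonneg B)]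
    refine Real.sqrt_le_sqrt ?_
    calc ∑ i, t j i ^ 2 ≤ ∑ _i : Fin n, B ^ 2 :=
          Finset.sum_le_sum fun i _ => sq_le_sq' (abs_le.1 (ht j i)).1 (abs_le.1 (ht j i)).2
      _ = B ^ 2 * n := by simp [mul_comm]
  calc ∑ j, ∑ σ, |∑ i, sgn σ i * t j i| ≤ ∑ _j : α, 2 ^ n * (B * √n) :=
        Finset.sum_le_sum fun j _ => h1 j
    _ = _ := by simp; ring

end Rademacher

/-! ### Symmetrization and Markov's inequality. -/

section Symmetrization

variable {Ω : Type*} [MeasurableSpace Ω] {ι : Type*} {n : ℕ}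

lemma abs_sum_sub_le {M : ℝ} {a b : Fin n → ℝ} (ha : ∀ i, |a i| ≤ M) (hb : ∀ i, |b i| ≤ M)
    (σ : Fin n → ℤˣ) : |∑ i, sgn σ i * (a i - b i)| ≤ n * (2 * M) := by
  calc |∑ i, sgn σ i * (a i - b i)| ≤ ∑ i, |sgn σ i * (a i - b i)| := Finset.abs_sum_le_sum_abs _ _
    _ ≤ ∑ _i : Fin n, 2 * M := Finset.sum_le_sum fun i _ => by
        rw [abs_mul, abs_sgn, one_mul]
        exact (abs_sub _ _).trans (by linarith [ha i, hb i])
    _ = n * (2 * M) := by simp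

lemma abs_ciSup_le [Nonempty ι] {f : ι → ℝ} {c : ℝ} (h : ∀ k, |f k| ≤ c) : |⨆ k, f k| ≤ c := by
  obtain ⟨k⟩ := ‹Nonempty ι›
  refine abs_le.2 ⟨?_, ciSup_le fun k => (le_abs_self _).trans (h k)⟩
  exact (abs_le.1 (h k)).1.trans (le_ciSup (f := f) ⟨c, by
    rintro _ ⟨l, rfl⟩; exact (le_abs_self _).trans (h l)⟩ k)

lemma integrable_of_measurable_of_abs_le {μ : Measure Ω} [IsFiniteMeasure μ] {f : Ω → ℝ} {C : ℝ}
    (hf : Measurable f) (h : ∀ ω, |f ω| ≤ C) : Integrable f μ :=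
  Integrable.of_bound hf.aestronglyMeasurable C (Filter.Eventually.of_forall h)

variable [Countable ι] [Nonempty ι] (P : Measure Ω) [IsProbabilityMeasure P]
  {G : ι → Ω → ℝ} {M K : ℝ}

/-- Random signs can be inserted in a symmetrized process. -/
lemma integral_iSup_sub_le (hG : ∀ k, Measurable (G k)) (hM : ∀ k ω, |G k ω| ≤ M)
    (hrad : ∀ s : Fin n → Ω, RademacherLE (fun k i => G k (s i)) K) :
    ∫ z, (⨆ k, ∑ i, (G k (z i).2 - G k (z i).1)) ∂(Measure.pi fun _ : Fin n => P.prod P) ≤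
      2 * K := by
  set ν := Measure.pi fun _ : Fin n => P.prod P
  let Φ : (Fin n → ℤˣ) → (Fin n → Ω × Ω) → ℝ := fun σ z =>
    ⨆ k, ∑ i, sgn σ i * (G k (z i).2 - G k (z i).1)
  have hm : ∀ σ, Measurable (Φ σ) := fun σ => Measurable.iSup fun k => by
    have := hG k
    fun_prop
  have hb : ∀ σ z, |Φ σ z| ≤ n * (2 * M) := fun σ z =>
    abs_ciSup_le fun k => abs_sum_sub_le (fun i => hM k _) (fun i => hM k _) σ
  have hi : ∀ σ, Integrable (Φ σ) ν := fun σ => integrable_of_measurable_of_abs_le (hm σ) (hb σ)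
  -- Exchanging the two members of the `i`-th pair wherever `σ i = -1` preserves the product measure
  -- and inserts the signs `σ`.
  have hswap : ∀ σ, ∫ z, Φ 1 z ∂ν = ∫ z, Φ σ z ∂ν := by
    intro σ
    let f : Fin n → Ω × Ω → Ω × Ω := fun i => if σ i = 1 then id else Prod.swap
    have hf : MeasurePreserving (fun (z : Fin n → Ω × Ω) i => f i (z i)) ν ν := by
      refine measurePreserving_pi _ _ fun i => ?_
      by_cases h : σ i = 1
      · simp only [f, h, if_true]
        exact MeasurePreserving.id _
      · simp only [f, h, if_false]
        exact Measure.measurePreserving_swap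
    have h1 : ∫ z, Φ 1 z ∂ν = ∫ z, Φ 1 (fun i => f i (z i)) ∂ν := by
      conv_lhs => rw [← hf.map_eq]
      exact integral_map hf.measurable.aemeasurable (hm 1).aestronglyMeasurable
    rw [h1]
    refine integral_congr_ae (Filter.Eventually.of_forall fun z => ?_)
    refine iSup_congr fun k => Finset.sum_congr rfl fun i _ => ?_
    rcases Int.units_eq_one_or (σ i) with h | h
    · simp [f, h, sgn]
    · simp [f, h, sgn]
  have hpt : ∀ z, ∑ σ, Φ σ z ≤ 2 ^ n * (2 * K) := by
    intro z
    obtain ⟨b, hb, hs⟩ := (hrad fun i => (z i).2).add (hrad fun i => (z i).1).neg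
    rw [two_mul K]
    refine le_trans (Finset.sum_le_sum fun σ _ => ciSup_le fun k => ?_) hs
    simpa only [sub_eq_add_neg] using hb σ k
  have h2 : (2 : ℝ) ^ n * ∫ z, Φ 1 z ∂ν ≤ 2 ^ n * (2 * K) := by
    calc (2 : ℝ) ^ n * ∫ z, Φ 1 z ∂ν = ∑ σ : Fin n → ℤˣ, ∫ z, Φ σ z ∂ν := by
          rw [← Finset.sum_congr rfl fun σ _ => hswap σ, Finset.sum_const, Finset.card_univ,
            card_signs]
          simp
      _ = ∫ z, ∑ σ, Φ σ z ∂ν := (integral_finsetSum _ fun σ _ => hi σ).symm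
      _ ≤ ∫ _z, (2 : ℝ) ^ n * (2 * K) ∂ν :=
          integral_mono (integrable_finsetSum _ fun σ _ => hi σ) (integrable_const _) hpt
      _ = 2 ^ n * (2 * K) := by simp
  have h3 := le_of_mul_le_mul_left h2 (by positivity)
  simpa [Φ, sgn] using h3

/-- Symmetrization: the expected one-sided uniform deviation is at most twice the Rademacher
average. -/
theorem integral_iSup_deviation_le (hG : ∀ k, Measurable (G k)) (hM : ∀ k ω, |G k ω| ≤ M)
    (hrad : ∀ s : Fin n → Ω, RademacherLE (fun k i => G k (s i)) K) :
    ∫ S, (⨆ k, ∑ i, (∫ ω, G k ω ∂P - G k (S i))) ∂(Measure.pi fun _ : Fin n => P) ≤ 2 * K := by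
  set Q := Measure.pi fun _ : Fin n => P
  -- `z.2` is a ghost sample: the mean of `G k` is its average over the ghost sample, and a supremum
  -- of integrals is at most the integral of the supremum.
  let Ψ : (Fin n → Ω) × (Fin n → Ω) → ℝ := fun z => ⨆ k, ∑ i, (G k (z.2 i) - G k (z.1 i))
  have hb0 : ∀ k (a b : Fin n → Ω), |∑ i, (G k (a i) - G k (b i))| ≤ n * (2 * M) := fun k a b => by
    simpa [sgn] using abs_sum_sub_le (a := fun i => G k (a i)) (b := fun i => G k (b i))
      (fun i => hM k _) (fun i => hM k _) 1
  have hΨm : Measurable Ψ := Measurable.iSup fun k => by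
    have := hG k
    fun_prop
  have hΨb : ∀ z, |Ψ z| ≤ n * (2 * M) := fun z => abs_ciSup_le fun k => hb0 k _ _
  have hΨi : Integrable Ψ (Q.prod Q) := integrable_of_measurable_of_abs_le hΨm hΨb
  have h1 : ∫ z, Ψ z ∂(Q.prod Q) ≤ 2 * K := by
    refine le_trans (le_of_eq ?_) (integral_iSup_sub_le P hG hM hrad)
    exact ((measurePreserving_arrowProdEquivProdArrow Ω Ω (Fin n) (fun _ => P)
      fun _ => P).integral_comp' Ψ).symm
  rw [integral_prod _ hΨi] at h1
  have hI : ∀ k, |∫ ω, G k ω ∂P| ≤ M := fun k => by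
    have := norm_integral_le_of_norm_le_const (μ := P) (f := G k) (C := M)
      (Filter.Eventually.of_forall (hM k))
    simpa using this
  have hDi : Integrable (fun S => ⨆ k, ∑ i, (∫ ω, G k ω ∂P - G k (S i))) Q := by
    refine integrable_of_measurable_of_abs_le (C := n * (2 * M)) (Measurable.iSup fun k => ?_)
      fun S => abs_ciSup_le fun k => ?_
    · have := hG k
      fun_prop
    · simpa [sgn] using abs_sum_sub_le (a := fun _ => ∫ ω, G k ω ∂P) (b := fun i => G k (S i))
        (fun i => hI k) (fun i => hM k _) 1
  refine le_trans (integral_mono hDi hΨi.integral_prod_left fun S => ciSup_le fun k => ?_) h1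
  have hGi : ∀ i, Integrable (fun S' : Fin n → Ω => G k (S' i)) Q := fun i =>
    integrable_of_measurable_of_abs_le ((hG k).comp (measurable_pi_apply i)) fun _ => hM k _
  have hGs : ∀ i, Integrable (fun S' : Fin n → Ω => G k (S' i) - G k (S i)) Q := fun i =>
    (hGi i).sub (integrable_const _)
  have h2 : ∑ i, (∫ ω, G k ω ∂P - G k (S i)) = ∫ S', ∑ i, (G k (S' i) - G k (S i)) ∂Q := by
    rw [integral_finsetSum _ fun i _ => hGs i]
    refine Finset.sum_congr rfl fun i _ => ?_
    rw [integral_sub (hGi i) (integrable_const _), integral_const, probReal_univ, one_smul,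
      integral_comp_eval (hG k).aestronglyMeasurable]
  rw [h2]
  refine integral_mono (integrable_finsetSum _ fun i _ => hGs i)
    (integrable_of_measurable_of_abs_le (hΨm.comp measurable_prodMk_left) fun _ => hΨb _)
    fun S' => ?_
  exact le_ciSup (f := fun k => ∑ i, (G k (S' i) - G k (S i)))
    ⟨n * (2 * M), by rintro _ ⟨l, rfl⟩; exact (le_abs_self _).trans (hb0 l _ _)⟩ k

/-- Markov's inequality for the one-sided uniform deviation. -/
theorem measureReal_exists_deviation_le (hG : ∀ k, Measurable (G k)) (hM : ∀ k ω, |G k ω| ≤ M)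
    (hrad : ∀ s : Fin n → Ω, RademacherLE (fun k i => G k (s i)) K) {k₀ : ι}
    (hk₀ : ∀ ω, G k₀ ω = 0) {τ : ℝ} (hτ : 0 < τ) :
    (Measure.pi fun _ : Fin n => P).real
      {S | ∃ k, τ < ∑ i, (∫ ω, G k ω ∂P - G k (S i))} ≤ 2 * K / τ := by
  set Q := Measure.pi fun _ : Fin n => P
  let D : (Fin n → Ω) → ℝ := fun S => ⨆ k, ∑ i, (∫ ω, G k ω ∂P - G k (S i))
  have hI : ∀ k, |∫ ω, G k ω ∂P| ≤ M := fun k => by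
    have := norm_integral_le_of_norm_le_const (μ := P) (f := G k) (C := M)
      (Filter.Eventually.of_forall (hM k))
    simpa using this
  have hb : ∀ k (S : Fin n → Ω), |∑ i, (∫ ω, G k ω ∂P - G k (S i))| ≤ n * (2 * M) := fun k S => by
    simpa [sgn] using abs_sum_sub_le (a := fun _ => ∫ ω, G k ω ∂P) (b := fun i => G k (S i))
      (fun i => hI k) (fun i => hM k _) 1
  have hle : ∀ S k, ∑ i, (∫ ω, G k ω ∂P - G k (S i)) ≤ D S := fun S k =>
    le_ciSup (f := fun k => ∑ i, (∫ ω, G k ω ∂P - G k (S i)))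
      ⟨n * (2 * M), by rintro _ ⟨l, rfl⟩; exact (le_abs_self _).trans (hb l S)⟩ k
  have hDi : Integrable D Q := by
    refine integrable_of_measurable_of_abs_le (C := n * (2 * M)) (Measurable.iSup fun k => ?_)
      fun S => abs_ciSup_le fun k => hb k S
    have := hG k
    fun_prop
  -- The zero member `k₀` makes the supremum nonnegative, as Markov's inequality requires.
  have hD0 : 0 ≤ᵐ[Q] D := Filter.Eventually.of_forall fun S => by
    simpa [hk₀] using hle S k₀
  have h1 := mul_meas_ge_le_integral_of_nonneg hD0 hDi τ
  rw [le_div_iff₀ hτ, mul_comm]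
  refine le_trans (mul_le_mul_of_nonneg_left (measureReal_mono ?_) hτ.le)
    (h1.trans (integral_iSup_deviation_le P hG hM hrad))
  rintro S ⟨k, hk⟩
  exact hk.le.trans (hle S k)

end Symmetrization

/-! ### Uniform deviations for uncountable classes. -/

/-- Every member of the family `G` is uniformly approximated on `s` by members with index in a
countable set. -/
def SepOn {Z ι : Type*} (G : ι → Z → ℝ) (s : Set Z) : Prop :=
  ∃ D : Set ι, D.Countable ∧ ∀ k, ∀ ε > 0, ∃ d ∈ D, ∀ z ∈ s, |G k z - G d z| ≤ ε

/-- Uniform deviation bound with high probability for a family separable in the sup norm. -/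
theorem exists_uniform_deviation_event {Ω Z ι : Type*} [MeasurableSpace Ω] [MeasurableSpace Z]
    (μ : Measure Ω) [IsProbabilityMeasure μ] {V : Ω → Z} (hV : Measurable V) {s : Set Z}
    (hs : MeasurableSet s) (hVs : ∀ ω, V ω ∈ s) {G : ι → Z → ℝ} (hG : ∀ k, Measurable (G k))
    {M K : ℝ} (hM : ∀ k, ∀ z ∈ s, |G k z| ≤ M) (hsep : SepOn G s)
    (hzero : ι → ∃ k₀, ∀ z ∈ s, G k₀ z = 0) {n : ℕ} (hn : 1 ≤ n) (hK : 0 < K)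
    (hrad : ∀ S : Fin n → Z, (∀ i, S i ∈ s) → RademacherLE (fun k i => G k (S i)) (K * √n))
    {δ : ℝ} (hδ : 0 < δ) :
    ∃ E : Set (Fin n → Z), MeasurableSet E ∧
      (Measure.pi fun _ : Fin n => μ.map V).real Eᶜ ≤ δ ∧
      ∀ S ∈ E, (∀ i, S i ∈ s) ∧
        ∀ k, ∫ ω, G k (V ω) ∂μ - 1 / (n : ℝ) * ∑ i, G k (S i) ≤ 2 * K / δ / √n := by
  have hprob : IsProbabilityMeasure (μ.map V) := Measure.isProbabilityMeasure_map hV.aemeasurable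
  have hn0 : (0 : ℝ) < n := by exact_mod_cast hn
  -- Pulled back to `Ω`, all observations lie in `s` everywhere and not just almost surely, so
  -- bounds valid only on `s` suffice.
  have hmap : (Measure.pi fun _ : Fin n => μ.map V) =
      (Measure.pi fun _ : Fin n => μ).map (fun ω i => V (ω i)) :=
    (Measure.pi_map_pi fun _ => hV.aemeasurable).symm
  have hVm : Measurable (fun (ω : Fin n → Ω) i => V (ω i)) := by fun_prop
  have hdom : MeasurableSet {S : Fin n → Z | ∀ i, S i ∈ s} := by
    rw [Set.ofPred_forall]
    exact MeasurableSet.iInter fun i => measurable_pi_apply i hs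
  -- `hzero` yields a zero member only from an existing index.
  rcases isEmpty_or_nonempty ι with hι | ⟨⟨k₁⟩⟩
  · refine ⟨_, hdom, ?_, fun S hS => ⟨hS, fun k => hι.elim k⟩⟩
    rw [hmap, map_measureReal_apply hVm hdom.compl]
    have : (fun (ω : Fin n → Ω) i => V (ω i)) ⁻¹' {S : Fin n → Z | ∀ i, S i ∈ s}ᶜ = ∅ := by
      ext ω; simp [hVs]
    simp [this, hδ.le]
  obtain ⟨k₀, hk₀⟩ := hzero k₁
  obtain ⟨D, hDc, hD⟩ := hsep
  set D' := insert k₀ D with hD'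
  have hD'c : D'.Countable := hDc.insert k₀
  have : Countable D' := hD'c.to_subtype
  have : Nonempty D' := ⟨⟨k₀, Set.mem_insert _ _⟩⟩
  -- The threshold at which Markov's bound `2 * (K * √n) / τ` equals `δ`.
  set τ := 2 * (K * √n) / δ with hτ
  have hτ0 : 0 < τ := by positivity
  have hmeas : ∀ d : D', MeasurableSet
      {S : Fin n → Z | ∑ i, (∫ ω, G d (V ω) ∂μ - G d (S i)) ≤ τ} := fun d => by
    have := hG d
    exact measurableSet_le (by fun_prop) measurable_const
  have hEm : MeasurableSet ({S : Fin n → Z | ∀ i, S i ∈ s} ∩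
      ⋂ d : D', {S : Fin n → Z | ∑ i, (∫ ω, G d (V ω) ∂μ - G d (S i)) ≤ τ}) :=
    hdom.inter (MeasurableSet.iInter hmeas)
  refine ⟨_, hEm, ?_, ?_⟩
  · rw [hmap, map_measureReal_apply hVm hEm.compl]
    have h1 := measureReal_exists_deviation_le (n := n) μ (G := fun (d : D') ω => G d (V ω))
      (M := M) (K := K * √n) (k₀ := ⟨k₀, Set.mem_insert _ _⟩) (fun d => (hG d).comp hV)
      (fun d ω => hM d _ (hVs ω))
      (fun S => (hrad (fun i => V (S i)) fun i => hVs _).reindex fun d : D' => (d : ι))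
      (fun ω => hk₀ _ (hVs ω)) hτ0
    have h2 : 2 * (K * √n) / τ = δ := by
      rw [hτ]
      field_simp
    rw [h2] at h1
    refine le_trans (measureReal_mono ?_) h1
    intro ω hω
    by_contra hcon
    refine hω ⟨fun i => hVs _, ?_⟩
    simpa using hcon
  · rintro S ⟨hS, hSE⟩
    -- Passing from `k` to a member of the countable family costs `ε / 2` in the mean and `ε / 2` in
    -- the empirical average.
    refine ⟨hS, fun k => le_of_forall_pos_le_add fun ε hε => ?_⟩
    obtain ⟨d, hd, hkd⟩ := hD k (ε / 2) (by positivity)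
    have hd' : ∑ i, (∫ ω, G d (V ω) ∂μ - G d (S i)) ≤ τ :=
      Set.mem_iInter.1 hSE ⟨d, Set.mem_insert_of_mem _ hd⟩
    rw [Finset.sum_sub_distrib, Finset.sum_const, Finset.card_univ, Fintype.card_fin,
      nsmul_eq_mul] at hd'
    have hint : ∀ l, Integrable (fun ω => G l (V ω)) μ := fun l =>
      integrable_of_measurable_of_abs_le ((hG l).comp hV) fun ω => hM l _ (hVs ω)
    have h1 : ∫ ω, G k (V ω) ∂μ ≤ ∫ ω, G d (V ω) ∂μ + ε / 2 := by
      have : ∫ ω, G k (V ω) ∂μ ≤ ∫ ω, (G d (V ω) + ε / 2) ∂μ :=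
        integral_mono (hint k) ((hint d).add (integrable_const _)) fun ω => by
          have := (abs_le.1 (hkd _ (hVs ω))).2
          simp only
          linarith
      rwa [integral_add (hint d) (integrable_const _), integral_const, probReal_univ,
        one_smul] at this
    have h2 : ∑ i, G d (S i) ≤ ∑ i, G k (S i) + n * (ε / 2) := by
      calc ∑ i, G d (S i) ≤ ∑ i, (G k (S i) + ε / 2) := Finset.sum_le_sum fun i _ => by
            linarith [(abs_le.1 (hkd _ (hS i))).1]
        _ = _ := by simp [Finset.sum_add_distrib]
    have h3 : 2 * K / δ / √n = τ / n := by
      rw [hτ]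
      field_simp
      rw [Real.sq_sqrt hn0.le]
    rw [h3, one_div, inv_mul_eq_div, ← sub_nonneg]
    have h4 : τ / n + ε - (∫ ω, G k (V ω) ∂μ - (∑ i, G k (S i)) / n) =
        (τ + n * ε - (n * ∫ ω, G k (V ω) ∂μ - ∑ i, G k (S i))) / n := by
      field_simp
    rw [h4]
    refine div_nonneg ?_ hn0.le
    nlinarith [mul_le_mul_of_nonneg_left h1 hn0.le]

/-! ### Norm-bounded ReLU networks -/

lemma matrixNorm_nonneg {p q : ℝ≥0∞} (hp : 1 ≤ p) (hq : 1 ≤ q) {m k : ℕ}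
    (W : Matrix (Fin m) (Fin k) ℝ) : 0 ≤ matrixNorm p q W := by
  have : Fact (1 ≤ p) := ⟨hp⟩
  have : Fact (1 ≤ q) := ⟨hq⟩
  exact Real.iSup_nonneg fun _ => by positivity

/-- Matrix entries are bounded by the operator norm. -/
lemma abs_entry_le_matrixNorm {p q : ℝ≥0∞} (hp : 1 ≤ p) (hq : 1 ≤ q) {m k : ℕ}
    (W : Matrix (Fin m) (Fin k) ℝ) (i : Fin m) (j : Fin k) : |W i j| ≤ matrixNorm p q W := by
  have : Fact (1 ≤ p) := ⟨hp⟩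
  have : Fact (1 ≤ q) := ⟨hq⟩
  let T : WithLp p (Fin k → ℝ) →ₗ[ℝ] WithLp q (Fin m → ℝ) :=
    (WithLp.linearEquiv q ℝ (Fin m → ℝ)).symm.toLinearMap ∘ₗ W.mulVecLin ∘ₗ
      (WithLp.linearEquiv p ℝ (Fin k → ℝ)).toLinearMap
  have hT : ∀ x : Fin k → ℝ, T (WithLp.toLp p x) = WithLp.toLp q (W.mulVec x) := fun x => rfl
  -- A real `⨆` over an unbounded set is `0`, so finiteness matters; linear maps in finite dimension
  -- are bounded.
  have hbdd : BddAbove (Set.range fun x : Fin k → ℝ =>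
      ‖WithLp.toLp q (W.mulVec x)‖ / ‖WithLp.toLp p x‖) := by
    refine ⟨‖LinearMap.toContinuousLinearMap T‖, ?_⟩
    rintro _ ⟨x, rfl⟩
    exact div_le_of_le_mul₀ (norm_nonneg _) (norm_nonneg _)
      ((LinearMap.toContinuousLinearMap T).le_opNorm (WithLp.toLp p x))
  have h1 := le_ciSup hbdd (Pi.single j 1)
  have h2 : ‖WithLp.toLp p (Pi.single j (1 : ℝ) : Fin k → ℝ)‖ = 1 := by
    simp
  rw [h2, div_one] at h1
  refine le_trans ?_ h1
  have h3 := PiLp.norm_apply_le (WithLp.toLp q (W.mulVec (Pi.single j (1 : ℝ)))) i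
  simpa using h3

lemma abs_max_zero_sub_le (x y : ℝ) : |max 0 x - max 0 y| ≤ |x - y| :=
  (abs_max_sub_max_le_max 0 x 0 y).trans (by simp)

lemma abs_max_zero_le (x : ℝ) : |max 0 x| ≤ |x| := by
  simpa using abs_max_zero_sub_le x 0

namespace ReLUNet

variable {H : ℕ}

lemma eval_smul : ∀ {k L : ℕ} (N : ReLUNet H k L) {c : ℝ} (_ : 0 ≤ c) (x : Fin k → ℝ),
    N.eval (c • x) = c * N.eval x
  | _, _, .last W, c, hc, x => by simp [eval, Matrix.mulVec_smul]
  | _, _, .cons W N, c, hc, x => by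
    simp only [eval]
    rw [← N.eval_smul hc]
    congr 1
    ext i
    simp [Matrix.mulVec_smul, mul_max_of_nonneg _ _ hc]

lemma eval_zero {k L : ℕ} (N : ReLUNet H k L) : N.eval 0 = 0 := by
  simpa using N.eval_smul le_rfl 0

lemma continuous_eval : ∀ {k L : ℕ} (N : ReLUNet H k L), Continuous N.eval
  | _, _, .last W => by
    have : Continuous fun s => W.mulVec s := by fun_prop
    exact (continuous_apply 0).comp this
  | _, _, .cons W N => by
    have h : Continuous fun s => W.mulVec s := by fun_prop
    exact N.continuous_eval.comp (continuous_pi fun i =>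
      continuous_const.max ((continuous_apply i).comp h))

lemma exists_eq_last {k : ℕ} (N : ReLUNet H k 1) : ∃ W, N = .last W := by
  cases N with
  | last W => exact ⟨W, rfl⟩
  | cons W N => nomatch N

lemma exists_eq_cons {k L : ℕ} (N : ReLUNet H k (L + 2)) : ∃ W N', N = .cons W N' := by
  cases N with
  | cons W N => exact ⟨W, N, rfl⟩

/-- The first layer can be normalized, by positive homogeneity. -/
lemma eval_cons_normalized {p q : ℝ≥0∞} (hp : 1 ≤ p) (hq : 1 ≤ q) {k L : ℕ}
    (W : Matrix (Fin H) (Fin k) ℝ) (N : ReLUNet H H L) (x : Fin k → ℝ) :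
    (cons W N).eval x = matrixNorm p q W *
      N.eval (fun i => max 0 ((((matrixNorm p q W)⁻¹ • W).mulVec x) i)) := by
  -- For norm zero the matrix vanishes, and both sides are `0` whatever the value of the inverse.
  rcases (matrixNorm_nonneg hp hq W).eq_or_lt with h | h
  · have hW : W = 0 := by
      ext i j
      have := abs_entry_le_matrixNorm hp hq W i j
      rw [← h] at this
      simpa using this
    rw [← h, zero_mul]
    subst hW
    simp only [eval, Matrix.zero_mulVec, Pi.zero_apply, max_self]
    exact N.eval_zero
  · rw [← N.eval_smul h.le, eval]
    congr 1
    ext i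
    simp only [Pi.smul_apply, smul_eq_mul, mul_max_of_nonneg _ _ h.le, mul_zero, Matrix.smul_mulVec]
    rw [mul_inv_cancel_left₀ h.ne']

/-- Peeling: Rademacher averages of norm-bounded networks evaluated on a family of inputs. -/
theorem exists_rademacherAbsLE (p q : ℝ≥0∞) (hp : 1 ≤ p) (hq : 1 ≤ q) {γ : ℝ} (hγ : 0 ≤ γ)
    (L : ℕ) : ∀ k : ℕ, ∃ C : ℝ, 0 ≤ C ∧ ∀ {n : ℕ} {κ : Type} (v : κ → Fin n → Fin k → ℝ)
      (N : κ → ReLUNet H k (L + 1)) (c : κ → ℝ) (K : ℝ), (∀ x, 0 ≤ c x) →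
      (∀ x, c x * (N x).normProd p q ≤ γ) →
      RademacherAbsLE (fun (y : κ × Fin k) i => v y.1 i y.2) K →
      RademacherAbsLE (fun x i => c x * (N x).eval (v x i)) (C * K) := by
  -- The scalar `c x` collects the norms of the layers already peeled off, since only the product of
  -- the norms is bounded. The inputs `v` depend on the network `x` because after one step they are
  -- outputs of its own first layer.
  induction L with
  | zero =>
    intro k
    refine ⟨k * γ, by positivity, fun {n κ} v N c K hc hN h => ?_⟩
    choose W hW using fun x => (N x).exists_eq_last
    have h1 := h.linear (fun x j => c x * W x 0 j) id (c := k * γ) (by positivity) fun x => by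
      calc ∑ j, |c x * W x 0 j| ≤ ∑ _j : Fin k, γ := Finset.sum_le_sum fun j _ => by
            rw [abs_mul, abs_of_nonneg (hc x)]
            refine le_trans (mul_le_mul_of_nonneg_left ?_ (hc x)) (hN x)
            rw [hW x]
            exact abs_entry_le_matrixNorm hp hq _ _ _
        _ = k * γ := by simp
    convert h1 using 3 with x i
    simp [hW x, eval, Matrix.mulVec, dotProduct, Finset.mul_sum, mul_assoc]
  | succ L ih =>
    intro k
    obtain ⟨C, hC, ih⟩ := ih H
    refine ⟨C * (2 * k), by positivity, fun {n κ} v N c K hc hN h => ?_⟩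
    choose W N' hW using fun x => (N x).exists_eq_cons
    -- Entries of the normalized matrix are at most `1` in absolute value, so each row has `ℓ¹`-norm
    -- at most `k`. The contraction for the ReLU then adds the factor `2`.
    have h1 := h.linear (κ := κ × Fin H)
      (fun y j => ((matrixNorm p q (W y.1))⁻¹ • W y.1) y.2 j) Prod.fst (c := k) (by positivity)
      fun y => by
        calc ∑ j, |((matrixNorm p q (W y.1))⁻¹ • W y.1) y.2 j| ≤ ∑ _j : Fin k, (1 : ℝ) :=
              Finset.sum_le_sum fun j _ => by
                rw [Matrix.smul_apply, smul_eq_mul, abs_mul,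
                  abs_of_nonneg (inv_nonneg.2 (matrixNorm_nonneg hp hq _)), inv_mul_eq_div]
                exact div_le_one_of_le₀ (abs_entry_le_matrixNorm hp hq _ _ _)
                  (matrixNorm_nonneg hp hq _)
          _ = k := by simp
    have h2 : RademacherAbsLE (fun (y : κ × Fin H) (i : Fin n) =>
        max 0 ((((matrixNorm p q (W y.1))⁻¹ • W y.1).mulVec (v y.1 i)) y.2)) (2 * (k * K)) := by
      refine h1.compare (fun i y z => ?_) fun i y => ?_
      · exact abs_max_zero_sub_le _ _
      · exact abs_max_zero_le _
    have h3 := ih (fun x i j =>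
      max 0 ((((matrixNorm p q (W x))⁻¹ • W x).mulVec (v x i)) j)) N' (fun x => c x * matrixNorm p q (W x)) _
      (fun x => mul_nonneg (hc x) (matrixNorm_nonneg hp hq _))
      (fun x => by
        have := hN x
        rw [hW x] at this
        simpa only [normProd, mul_assoc] using this) h2
    convert h3.mono (le_of_eq (show C * (2 * (k * K)) = C * (2 * k) * K by ring)) using 3 with x i
    rw [hW x, eval_cons_normalized hp hq, mul_assoc]

end ReLUNet

lemma abs_ramp_sub_le (x y : ℝ) : |ramp x - ramp y| ≤ |x - y| := by
  refine (abs_min_sub_min_le_max _ _ _ _).trans ?_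
  simp only [sub_self, abs_zero]
  exact max_le (abs_nonneg _) (abs_max_zero_sub_le _ _)

lemma ramp_zero : ramp 0 = 0 := by simp [ramp]

lemma ramp_nonneg (x : ℝ) : 0 ≤ ramp x := le_min zero_le_one (le_max_left _ _)

lemma ramp_le_one (x : ℝ) : ramp x ≤ 1 := min_le_left _ _

lemma continuous_ramp : Continuous ramp := by unfold ramp; fun_prop

lemma continuous_of_mem_netClass {N : NetParams} {D : ℕ} {f : (Fin D → ℝ) → ℝ}
    (hf : f ∈ netClass N D) : Continuous f := by
  obtain ⟨net, -, rfl⟩ := hf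
  exact net.continuous_eval

lemma continuous_of_mem_rampNetClass {N : NetParams} {D : ℕ} {f : (Fin D → ℝ) → ℝ}
    (hf : f ∈ rampNetClass N D) : Continuous f := by
  obtain ⟨f₀, hf₀, rfl⟩ := hf
  exact continuous_ramp.comp (continuous_of_mem_netClass hf₀)

lemma abs_le_one_of_mem_rampNetClass {N : NetParams} {D : ℕ} {f : (Fin D → ℝ) → ℝ}
    (hf : f ∈ rampNetClass N D) (s : Fin D → ℝ) : |f s| ≤ 1 := by
  obtain ⟨f₀, -, rfl⟩ := hf
  exact abs_le.2 ⟨by linarith [ramp_nonneg (f₀ s)], ramp_le_one _⟩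

/-! ### Rademacher bounds for the hypothesis classes. -/

theorem netClass_rademacherAbsLE (N : NetParams) (D : ℕ) (B : ℝ) :
    ∃ C : ℝ, 0 ≤ C ∧ ∀ (n : ℕ) (s : Fin n → Fin D → ℝ), (∀ i, ‖s i‖ ≤ B) →
      RademacherAbsLE (fun (f : netClass N D) i => f.1 (s i)) (C * √n) := by
  obtain ⟨L, hL⟩ : ∃ L, N.L = L + 1 := ⟨N.L - 1, by have := N.one_le_L; omega⟩
  -- Peeling needs a nonnegative bound, while `N.γ` may be negative (the class is then empty).
  obtain ⟨C, hC, h⟩ := ReLUNet.exists_rademacherAbsLE (H := N.H) N.p N.q N.one_le_p N.one_le_q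
    (le_max_right N.γ 0) L D
  refine ⟨C * (D * |B|), by positivity, fun n s hs => ?_⟩
  have h1 : RademacherAbsLE (fun (j : Fin D) (i : Fin n) => s i j) (D * |B| * √n) := by
    simpa using RademacherAbsLE.of_finite (abs_nonneg B) (fun (j : Fin D) (i : Fin n) => s i j)
      fun j i => (norm_le_pi_norm (s i) j).trans ((hs i).trans (le_abs_self B))
  have hnet : ∀ f : netClass N D, ∃ net : ReLUNet N.H D (L + 1),
      net.normProd N.p N.q ≤ N.γ ∧ f.1 = net.eval := fun f => by
    rw [← hL]
    exact f.2
  choose net hnet hf using hnet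
  have h2 := h (fun _ => s) net (fun _ => 1) _ (fun _ => zero_le_one)
    (fun f => by
      rw [one_mul]
      exact (hnet f).trans (le_max_left _ _))
    (h1.reindex (Prod.snd : netClass N D × Fin D → Fin D))
  convert h2 using 1
  · ext f i
    rw [hf f, one_mul]
  · ring

/-- `ramp` is `1`-Lipschitz and fixes `0`, so contraction loses only a factor `2`. -/
theorem rampNetClass_rademacherAbsLE (N : NetParams) (D : ℕ) (B : ℝ) :
    ∃ C : ℝ, 0 ≤ C ∧ ∀ (n : ℕ) (s : Fin n → Fin D → ℝ), (∀ i, ‖s i‖ ≤ B) →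
      RademacherAbsLE (fun (f : rampNetClass N D) i => f.1 (s i)) (C * √n) := by
  obtain ⟨C, hC, h⟩ := netClass_rademacherAbsLE N D B
  refine ⟨2 * C, by positivity, fun n s hs => ?_⟩
  choose f₀ hf₀ hf using fun f : rampNetClass N D => f.2
  have h1 := (h n s hs).reindex fun f : rampNetClass N D => (⟨f₀ f, hf₀ f⟩ : netClass N D)
  rw [mul_assoc]
  refine h1.compare (fun i f g => ?_) fun i f => ?_
  · rw [hf f, hf g]
    exact abs_ramp_sub_le _ _
  · have := abs_ramp_sub_le (f₀ f (s i)) 0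
    rwa [ramp_zero, sub_zero, sub_zero, ← congrFun (hf f) (s i)] at this

/-- Products of families bounded by one. -/
lemma RademacherAbsLE.mul {ι : Type*} {n : ℕ} {t u : ι → Fin n → ℝ} {K K' : ℝ}
    (h : RademacherAbsLE t K) (h' : RademacherAbsLE u K') (ht : ∀ k i, |t k i| ≤ 1)
    (hu : ∀ k i, |u k i| ≤ 1) : RademacherAbsLE (fun k i => t k i * u k i) (4 * (K + K')) := by
  -- Polarization, `t u = (t + u)² / 4 - (t - u)² / 4`: on `[-2, 2]` the map `x ↦ x² / 4` is a
  -- contraction fixing zero.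
  have key : ∀ x y : ℝ, |x| ≤ 2 → |y| ≤ 2 → |x ^ 2 / 4 - y ^ 2 / 4| ≤ |x - y| := by
    intro x y hx hy
    have : x ^ 2 / 4 - y ^ 2 / 4 = (x + y) / 4 * (x - y) := by ring
    rw [this, abs_mul]
    refine mul_le_of_le_one_left (abs_nonneg _) ?_
    rw [abs_div, div_le_one (by simp)]
    simpa using (abs_add_le x y).trans (by linarith)
  have b1 : ∀ k i, |t k i + u k i| ≤ 2 := fun k i =>
    (abs_add_le _ _).trans (by linarith [ht k i, hu k i])
  have b2 : ∀ k i, |t k i + -u k i| ≤ 2 := fun k i =>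
    (abs_add_le _ _).trans (by rw [abs_neg]; linarith [ht k i, hu k i])
  have h1 := (h.add h').compare (u := fun k i => (t k i + u k i) ^ 2 / 4)
    (fun i k l => key _ _ (b1 k i) (b1 l i))
    (fun i k => by simpa using key _ 0 (b1 k i) (by simp))
  have h2 := (h.add h'.neg).compare (u := fun k i => (t k i + -u k i) ^ 2 / 4)
    (fun i k l => key _ _ (b2 k i) (b2 l i))
    (fun i k => by simpa using key _ 0 (b2 k i) (by simp))
  convert h1.add h2.neg using 1
  · ext k i
    ring
  · ring

/-- Each coordinate of the tensor product is a product of two truncated networks, and the weights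
form a linear combination of `ℓ¹`-norm at most `R`. -/
theorem firstStageClass_rademacherAbsLE (N : NetParams) {R : ℝ} (hR : 0 ≤ R)
    (DA DX d₁ d₂ : ℕ) (B : ℝ) :
    ∃ C : ℝ, 0 ≤ C ∧ ∀ (n : ℕ) (s : Fin n → (Fin DA → ℝ) × (Fin DX → ℝ)),
      (∀ i, ‖(s i).1‖ ≤ B) → (∀ i, ‖(s i).2‖ ≤ B) →
      RademacherAbsLE (fun (h : firstStageClass N R DA DX d₁ d₂) i => h.1.fn (s i).1 (s i).2)
        (C * √n) := by
  obtain ⟨C₁, hC₁, h₁⟩ := rampNetClass_rademacherAbsLE N DA B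
  obtain ⟨C₂, hC₂, h₂⟩ := rampNetClass_rademacherAbsLE N DX B
  refine ⟨R * (4 * (C₁ + C₂)), by positivity, fun n s hs₁ hs₂ => ?_⟩
  have e₁ := (h₁ n _ hs₁).reindex
    fun y : firstStageClass N R DA DX d₁ d₂ × (Fin d₁ × Fin d₂) =>
      (⟨fun s => y.1.1.φA s y.2.1, y.1.2.2.1 y.2.1⟩ : rampNetClass N DA)
  have e₂ := (h₂ n _ hs₂).reindex
    fun y : firstStageClass N R DA DX d₁ d₂ × (Fin d₁ × Fin d₂) =>
      (⟨fun s => y.1.1.φX s y.2.2, y.1.2.2.2 y.2.2⟩ : rampNetClass N DX)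
  have h3 := (e₁.mul e₂ (fun y i => abs_le_one_of_mem_rampNetClass (y.1.2.2.1 y.2.1) _)
    fun y i => abs_le_one_of_mem_rampNetClass (y.1.2.2.2 y.2.2) _).linear
      (fun (h : firstStageClass N R DA DX d₁ d₂) j => h.1.w j.1 j.2) id hR fun h => by
        rw [Fintype.sum_prod_type]
        exact h.2.1
  convert h3 using 1
  · ext h i
    simp [FirstStage.fn, tensorForm, Fintype.sum_prod_type]
  · ring

/-! ### Separability -/

/-- Subsets of separable metric spaces are separable, so the approximants can be taken inside the
range of `F`. -/
lemma exists_countable_dense_index {ι X : Type*} [PseudoMetricSpace X]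
    [SecondCountableTopology X] (F : ι → X) :
    ∃ D : Set ι, D.Countable ∧ ∀ k, ∀ ε > 0, ∃ d ∈ D, dist (F k) (F d) < ε := by
  obtain ⟨t, ht, htc, htd⟩ :=
    (TopologicalSpace.IsSeparable.of_separableSpace (Set.range F)).exists_countable_dense_subset
  choose g hg using fun x : t => ht x.2
  have := htc.to_subtype
  refine ⟨Set.range g, Set.countable_range g, fun k ε hε => ?_⟩
  obtain ⟨x, hx, hd⟩ := Metric.mem_closure_iff.1 (htd (Set.mem_range_self k)) ε hε
  exact ⟨g ⟨x, hx⟩, Set.mem_range_self _, by rwa [hg]⟩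

/-- Continuous functions on a compact set form a separable space in the sup norm. The compact `t` is
needed because the domains are bounded but not closed. -/
lemma sepOn_of_continuous {ι Z : Type*} [MetricSpace Z] {G : ι → Z → ℝ}
    (hG : ∀ k, Continuous (G k)) {s t : Set Z} (ht : IsCompact t) (hst : s ⊆ t) : SepOn G s := by
  have : CompactSpace t := isCompact_iff_compactSpace.1 ht
  obtain ⟨D, hD, h⟩ := exists_countable_dense_index
    fun k => (⟨fun z : t => G k z, (hG k).comp continuous_subtype_val⟩ : C(t, ℝ))
  refine ⟨D, hD, fun k ε hε => ?_⟩
  obtain ⟨d, hd, hkd⟩ := h k ε hε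
  exact ⟨d, hd, fun z hz => ((ContinuousMap.dist_lt_iff hε).1 hkd ⟨z, hst hz⟩).le⟩

/-! ### Identification in the back-door model -/

lemma integral_bind_kernel {α β : Type*} [MeasurableSpace α] [MeasurableSpace β] (m : Measure α)
    [SFinite m] (κ : Kernel α β) [IsMarkovKernel κ] {f : β → ℝ} (hf : Integrable f (m.bind κ)) :
    ∫ y, f y ∂(m.bind κ) = ∫ x, ∫ y, f y ∂(κ x) ∂m := by
  rw [Measure.comp_eq_comp_const_apply] at hf ⊢
  rw [Kernel.integral_comp hf]
  simp

namespace BackdoorModel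

variable {Ω : Type*} [MeasurableSpace Ω] {DA DX : ℕ} {R : ℝ} (M : BackdoorModel Ω DA DX R)

instance : IsProbabilityMeasure M.μ := M.isProb
instance : IsMarkovKernel M.condX := M.isMarkov_condX
instance : IsMarkovKernel M.condΩ := M.isMarkov_condΩ

lemma nonempty_Ω (M : BackdoorModel Ω DA DX R) : Nonempty Ω := nonempty_of_isProbabilityMeasure M.μ

lemma abs_Y_le (ω : Ω) : |M.Y ω| ≤ R := by
  rw [M.consistency]
  exact M.Ypot_bound _ (M.A_mem ω) ω

lemma R_nonneg (M : BackdoorModel Ω DA DX R) : 0 ≤ R := by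
  obtain ⟨ω⟩ := M.nonempty_Ω
  exact (abs_nonneg _).trans (M.abs_Y_le ω)

lemma measurable_AX : Measurable fun ω => (M.A ω, M.X ω) :=
  M.measurable_A.prodMk M.measurable_X

/-- Disintegration along `(A, X)`. -/
lemma integral_eq_integral_condΩ {f : Ω → ℝ} (hf : Integrable f M.μ) :
    ∫ ω, f ω ∂M.μ = ∫ ω, ∫ ω', f ω' ∂(M.condΩ (M.A ω, M.X ω)) ∂M.μ := by
  have hp : IsProbabilityMeasure (M.μ.map fun ω => (M.A ω, M.X ω)) :=
    Measure.isProbabilityMeasure_map M.measurable_AX.aemeasurable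
  have hf' : Integrable f ((M.μ.map fun ω => (M.A ω, M.X ω)).bind M.condΩ) := by
    rwa [M.condΩ_spec]
  have h := integral_bind_kernel _ M.condΩ hf'
  rw [M.condΩ_spec] at h
  rw [h]
  refine integral_map M.measurable_AX.aemeasurable ?_
  rw [Measure.comp_eq_comp_const_apply] at hf'
  have := hf'.integral_comp
  simpa using this.1

/-- Disintegration of the law of `(A, X)` along `A`. -/
lemma integral_eq_integral_condX {F : (Fin DA → ℝ) → (Fin DX → ℝ) → ℝ}
    (hF : Measurable (Function.uncurry F)) {C : ℝ} (hC : ∀ a ∈ M.𝒜, ∀ x ∈ M.𝒳, |F a x| ≤ C) :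
    ∫ ω, F (M.A ω) (M.X ω) ∂M.μ = ∫ ω, ∫ x, F (M.A ω) x ∂(M.condX (M.A ω)) ∂M.μ := by
  have hp : IsProbabilityMeasure (M.μ.map M.A) :=
    Measure.isProbabilityMeasure_map M.measurable_A.aemeasurable
  have h1 : ∫ ω, F (M.A ω) (M.X ω) ∂M.μ =
      ∫ z, Function.uncurry F z ∂(M.μ.map fun ω => (M.A ω, M.X ω)) :=
    (integral_map M.measurable_AX.aemeasurable hF.aestronglyMeasurable).symm
  have hi : Integrable (Function.uncurry F) ((M.μ.map M.A).compProd M.condX) := by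
    rw [M.condX_spec, integrable_map_measure hF.aestronglyMeasurable M.measurable_AX.aemeasurable]
    exact integrable_of_measurable_of_abs_le (hF.comp M.measurable_AX)
      fun ω => hC _ (M.A_mem ω) _ (M.X_mem ω)
  rw [h1, ← M.condX_spec, Measure.integral_compProd hi]
  exact integral_map M.measurable_A.aemeasurable
    (hF.stronglyMeasurable.integral_kernel_prod_right').aestronglyMeasurable

/-- Exchangeability, a statement on laws, moves the treatment from `a'` to `a`; on the fiber `A =
a`, consistency turns the potential outcome into `Y`. -/
lemma integral_Ypot_condΩ {a a' : Fin DA → ℝ} (ha : a ∈ M.𝒜) (ha' : a' ∈ M.𝒜)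
    {x : Fin DX → ℝ} (hx : x ∈ M.𝒳) :
    ∫ ω, M.Ypot a ω ∂(M.condΩ (a', x)) = M.g a x := by
  have h : ∀ m : Measure Ω, ∫ ω, M.Ypot a ω ∂m = ∫ y, y ∂(m.map (M.Ypot a)) := fun m =>
    (integral_map (M.measurable_Ypot a ha).aemeasurable
      measurable_id.aestronglyMeasurable).symm
  rw [h, M.exchangeable a ha a' ha' x hx, ← h, g]
  refine integral_congr_ae ?_
  filter_upwards [M.condΩ_fiber a ha x hx] with ω hω
  rw [M.consistency, hω.1]

lemma integrable_Ypot {a : Fin DA → ℝ} (ha : a ∈ M.𝒜) (m : Measure Ω) [IsFiniteMeasure m] :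
    Integrable (M.Ypot a) m :=
  integrable_of_measurable_of_abs_le (M.measurable_Ypot a ha) (M.Ypot_bound a ha)

/-- The back-door formula for the average treatment effect. -/
lemma ate_eq {a : Fin DA → ℝ} (ha : a ∈ M.𝒜) : M.ate a = ∫ ω, M.g a (M.X ω) ∂M.μ := by
  rw [ate, M.integral_eq_integral_condΩ (M.integrable_Ypot ha _)]
  exact integral_congr_ae (Filter.Eventually.of_forall fun ω =>
    M.integral_Ypot_condΩ ha (M.A_mem ω) (M.X_mem ω))

/-- The back-door formula for the average treatment effect on the treated. -/
lemma att_eq {a a' : Fin DA → ℝ} (ha : a ∈ M.𝒜) (ha' : a' ∈ M.𝒜) :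
    M.att a a' = ∫ x, M.g a x ∂(M.condX a') := by
  let κ : Kernel (Fin DX → ℝ) Ω := M.condΩ.comap (fun x => (a', x)) measurable_prodMk_left
  have h1 : M.condGivenA a' = (M.condX a').bind κ := rfl
  rw [att, h1, integral_bind_kernel _ κ (M.integrable_Ypot ha _)]
  refine integral_congr_ae ?_
  filter_upwards [M.condX_mem a' ha'] with x hx
  exact M.integral_Ypot_condΩ ha ha' hx

/-- `Y - g(A, X)` is orthogonal to bounded functions of `(A, X)`. -/
lemma integral_Y_mul {k f : (Fin DA → ℝ) → (Fin DX → ℝ) → ℝ}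
    (hk : Measurable (Function.uncurry k)) {C : ℝ} (hC : ∀ a ∈ M.𝒜, ∀ x ∈ M.𝒳, |k a x| ≤ C)
    (hf : ∀ a ∈ M.𝒜, ∀ x ∈ M.𝒳, f a x = M.g a x) :
    ∫ ω, M.Y ω * k (M.A ω) (M.X ω) ∂M.μ =
      ∫ ω, f (M.A ω) (M.X ω) * k (M.A ω) (M.X ω) ∂M.μ := by
  have hkm : Measurable fun ω => k (M.A ω) (M.X ω) := hk.comp M.measurable_AX
  have hi : Integrable (fun ω => M.Y ω * k (M.A ω) (M.X ω)) M.μ :=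
    integrable_of_measurable_of_abs_le (C := R * C) (M.measurable_Y.mul hkm) fun ω => by
      rw [abs_mul]
      exact mul_le_mul (M.abs_Y_le ω) (hC _ (M.A_mem ω) _ (M.X_mem ω)) (abs_nonneg _) M.R_nonneg
  rw [M.integral_eq_integral_condΩ hi]
  refine integral_congr_ae (Filter.Eventually.of_forall fun ω => ?_)
  simp only
  rw [hf _ (M.A_mem ω) _ (M.X_mem ω), g, ← integral_mul_const]
  refine integral_congr_ae ?_
  filter_upwards [M.condΩ_fiber _ (M.A_mem ω) _ (M.X_mem ω)] with ω' hω'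
  rw [hω'.1, hω'.2]

/-- The excess risk of the first stage. -/
lemma integral_excess_first {h f : (Fin DA → ℝ) → (Fin DX → ℝ) → ℝ}
    (hm : Measurable (Function.uncurry h)) (fm : Measurable (Function.uncurry f)) {C : ℝ}
    (hC : ∀ a ∈ M.𝒜, ∀ x ∈ M.𝒳, |h a x| ≤ C) (fC : ∀ a ∈ M.𝒜, ∀ x ∈ M.𝒳, |f a x| ≤ C)
    (hf : ∀ a ∈ M.𝒜, ∀ x ∈ M.𝒳, f a x = M.g a x) :
    ∫ ω, ((M.Y ω - h (M.A ω) (M.X ω)) ^ 2 - (M.Y ω - f (M.A ω) (M.X ω)) ^ 2) ∂M.μ =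
      ∫ ω, (h (M.A ω) (M.X ω) - f (M.A ω) (M.X ω)) ^ 2 ∂M.μ := by
  have hkm : Measurable (Function.uncurry fun a x => h a x - f a x) := hm.sub fm
  have hkC : ∀ a ∈ M.𝒜, ∀ x ∈ M.𝒳, |h a x - f a x| ≤ C + C := fun a ha x hx =>
    (abs_sub _ _).trans (add_le_add (hC a ha x hx) (fC a ha x hx))
  have hort := M.integral_Y_mul hkm hkC hf
  have m1 : Measurable fun ω => h (M.A ω) (M.X ω) := hm.comp M.measurable_AX
  have m2 : Measurable fun ω => f (M.A ω) (M.X ω) := fm.comp M.measurable_AX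
  have b : ∀ ω, |h (M.A ω) (M.X ω) - f (M.A ω) (M.X ω)| ≤ C + C := fun ω =>
    hkC _ (M.A_mem ω) _ (M.X_mem ω)
  have b0 : 0 ≤ C + C := by
    obtain ⟨ω⟩ := M.nonempty_Ω
    exact (abs_nonneg _).trans (b ω)
  have i1 : Integrable (fun ω => (h (M.A ω) (M.X ω) - f (M.A ω) (M.X ω)) ^ 2) M.μ :=
    integrable_of_measurable_of_abs_le (C := (C + C) ^ 2) ((m1.sub m2).pow_const 2) fun ω => by
      rw [abs_pow]
      exact pow_le_pow_left₀ (abs_nonneg _) (b ω) 2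
  have i2 : Integrable (fun ω => M.Y ω * (h (M.A ω) (M.X ω) - f (M.A ω) (M.X ω))) M.μ :=
    integrable_of_measurable_of_abs_le (C := R * (C + C)) (M.measurable_Y.mul (m1.sub m2))
      fun ω => by
        rw [abs_mul]
        exact mul_le_mul (M.abs_Y_le ω) (b ω) (abs_nonneg _) M.R_nonneg
  have i3 : Integrable
      (fun ω => f (M.A ω) (M.X ω) * (h (M.A ω) (M.X ω) - f (M.A ω) (M.X ω))) M.μ :=
    integrable_of_measurable_of_abs_le (C := (C + C) * (C + C)) (m2.mul (m1.sub m2))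
      fun ω => by
        rw [abs_mul]
        refine mul_le_mul ?_ (b ω) (abs_nonneg _) b0
        linarith [fC _ (M.A_mem ω) _ (M.X_mem ω)]
  -- The bracket multiplied by `2` is the cross term, which integrates to zero by orthogonality.
  have e : ∀ ω, (M.Y ω - h (M.A ω) (M.X ω)) ^ 2 - (M.Y ω - f (M.A ω) (M.X ω)) ^ 2 =
      (h (M.A ω) (M.X ω) - f (M.A ω) (M.X ω)) ^ 2 -
        2 * (M.Y ω * (h (M.A ω) (M.X ω) - f (M.A ω) (M.X ω)) -
          f (M.A ω) (M.X ω) * (h (M.A ω) (M.X ω) - f (M.A ω) (M.X ω))) := fun ω => by ring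
  have i4 : Integrable (fun ω => 2 * (M.Y ω * (h (M.A ω) (M.X ω) - f (M.A ω) (M.X ω)) -
      f (M.A ω) (M.X ω) * (h (M.A ω) (M.X ω) - f (M.A ω) (M.X ω)))) M.μ := (i2.sub i3).const_mul 2
  simp_rw [e]
  rw [integral_sub i1 i4, integral_const_mul, integral_sub i2 i3, hort]
  ring

/-- The excess risk of the second stage. -/
lemma integral_excess_second {φ : (Fin DX → ℝ) → ℝ} {f f₀ : (Fin DA → ℝ) → ℝ}
    (hφ : Measurable φ) (hf : Measurable f) (hf₀ : Measurable f₀) (bφ : ∀ x, |φ x| ≤ 1)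
    (bf : ∀ a ∈ M.𝒜, |f a| ≤ 1) (bf₀ : ∀ a ∈ M.𝒜, |f₀ a| ≤ 1)
    (h : ∀ a ∈ M.𝒜, f₀ a = ∫ x, φ x ∂(M.condX a)) :
    ∫ ω, ((φ (M.X ω) - f (M.A ω)) ^ 2 - (φ (M.X ω) - f₀ (M.A ω)) ^ 2) ∂M.μ =
      ∫ ω, (f (M.A ω) - f₀ (M.A ω)) ^ 2 ∂M.μ := by
  have b : ∀ a ∈ M.𝒜, |f a - f₀ a| ≤ 2 := fun a ha =>
    (abs_sub _ _).trans (by linarith [bf a ha, bf₀ a ha])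
  have key : ∀ a ∈ M.𝒜, ∀ x, |(φ x - f a) ^ 2 - (φ x - f₀ a) ^ 2| ≤ 8 := fun a ha x => by
    have e : (φ x - f a) ^ 2 - (φ x - f₀ a) ^ 2 =
      (f a - f₀ a) * (f a + f₀ a - 2 * φ x) := by ring
    have b' : |f a + f₀ a - 2 * φ x| ≤ 4 := by
      have h1 := abs_le.1 (bf a ha)
      have h2 := abs_le.1 (bf₀ a ha)
      have h3 := abs_le.1 (bφ x)
      exact abs_le.2 ⟨by linarith, by linarith⟩
    rw [e, abs_mul]
    nlinarith [b a ha, abs_nonneg (f a - f₀ a)]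
  rw [M.integral_eq_integral_condX (F := fun a x => (φ x - f a) ^ 2 - (φ x - f₀ a) ^ 2) (C := 8)
    (by unfold Function.uncurry; fun_prop) fun a ha x _ => key a ha x]
  -- Given `A`, the feature enters the difference of squares linearly, so its conditional mean `f₀`
  -- may replace it; this completes the square.
  refine integral_congr_ae (Filter.Eventually.of_forall fun ω => ?_)
  have hi : Integrable φ (M.condX (M.A ω)) := integrable_of_measurable_of_abs_le hφ bφ
  have e : ∀ x, (φ x - f (M.A ω)) ^ 2 - (φ x - f₀ (M.A ω)) ^ 2 =
      (f (M.A ω) ^ 2 - f₀ (M.A ω) ^ 2) - 2 * (f (M.A ω) - f₀ (M.A ω)) * φ x := fun x => by ring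
  simp_rw [e]
  rw [integral_sub (integrable_const _) (hi.const_mul _), integral_const, integral_const_mul,
    ← h _ (M.A_mem ω), probReal_univ, one_smul]
  ring

end BackdoorModel

/-! ### The regression functions of the first stage -/

section FirstStage

variable {DA DX d₁ d₂ : ℕ} {N : NetParams} {R : ℝ} {h : FirstStage DA DX d₁ d₂}

lemma abs_tensorForm_le {w : Fin d₁ → Fin d₂ → ℝ} {u : Fin d₁ → ℝ} {v : Fin d₂ → ℝ} {ε : ℝ}
    (hw : ∑ i, ∑ j, |w i j| ≤ R) (hu : ∀ i, |u i| ≤ 1) (hv : ∀ j, |v j| ≤ ε) (hε : 0 ≤ ε) :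
    |tensorForm w u v| ≤ R * ε := by
  calc |tensorForm w u v| ≤ ∑ i, ∑ j, |w i j| * ε := by
        refine (Finset.abs_sum_le_sum_abs _ _).trans (Finset.sum_le_sum fun i _ =>
          (Finset.abs_sum_le_sum_abs _ _).trans (Finset.sum_le_sum fun j _ => ?_))
        rw [abs_mul, abs_mul]
        refine mul_le_mul_of_nonneg_left ?_ (abs_nonneg _)
        exact (mul_le_mul (hu i) (hv j) (abs_nonneg _) zero_le_one).trans_eq (one_mul ε)
    _ = (∑ i, ∑ j, |w i j|) * ε := by simp_rw [Finset.sum_mul]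
    _ ≤ R * ε := mul_le_mul_of_nonneg_right hw hε

lemma tensorForm_sub (w : Fin d₁ → Fin d₂ → ℝ) (u : Fin d₁ → ℝ) (v v' : Fin d₂ → ℝ) :
    tensorForm w u v - tensorForm w u v' = tensorForm w u (fun j => v j - v' j) := by
  simp only [tensorForm, ← Finset.sum_sub_distrib]
  exact Finset.sum_congr rfl fun i _ => Finset.sum_congr rfl fun j _ => by ring

lemma tensorForm_average {n : ℕ} (w : Fin d₁ → Fin d₂ → ℝ) (u : Fin d₁ → ℝ)
    (v : Fin n → Fin d₂ → ℝ) (c : ℝ) :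
    tensorForm w u (fun j => c * ∑ i, v i j) = c * ∑ i, tensorForm w u (v i) := by
  simp only [tensorForm, Finset.mul_sum]
  symm
  rw [Finset.sum_comm]
  refine Finset.sum_congr rfl fun a _ => ?_
  rw [Finset.sum_comm]
  exact Finset.sum_congr rfl fun b _ => Finset.sum_congr rfl fun i _ => by ring

lemma integral_tensorForm {Z : Type*} [MeasurableSpace Z] {m : Measure Z}
    (w : Fin d₁ → Fin d₂ → ℝ) (u : Fin d₁ → ℝ) {v : Z → Fin d₂ → ℝ}
    (hv : ∀ j, Integrable (fun z => v z j) m) :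
    ∫ z, tensorForm w u (v z) ∂m = tensorForm w u (fun j => ∫ z, v z j ∂m) := by
  simp only [tensorForm]
  rw [integral_finsetSum _ fun i _ => integrable_finsetSum _ fun j _ =>
    ((hv j).const_mul _).const_mul _]
  refine Finset.sum_congr rfl fun i _ => ?_
  rw [integral_finsetSum _ fun j _ => ((hv j).const_mul _).const_mul _]
  refine Finset.sum_congr rfl fun j _ => ?_
  rw [integral_const_mul, integral_const_mul]

lemma abs_φA_le (hh : h ∈ firstStageClass N R DA DX d₁ d₂) (a : Fin DA → ℝ) (i : Fin d₁) :
    |h.φA a i| ≤ 1 := abs_le_one_of_mem_rampNetClass (hh.2.1 i) a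

lemma abs_φX_le (hh : h ∈ firstStageClass N R DA DX d₁ d₂) (x : Fin DX → ℝ) (j : Fin d₂) :
    |h.φX x j| ≤ 1 := abs_le_one_of_mem_rampNetClass (hh.2.2 j) x

lemma continuous_φX (hh : h ∈ firstStageClass N R DA DX d₁ d₂) (j : Fin d₂) :
    Continuous fun x => h.φX x j := continuous_of_mem_rampNetClass (hh.2.2 j)

lemma abs_fn_le (hh : h ∈ firstStageClass N R DA DX d₁ d₂) (a : Fin DA → ℝ) (x : Fin DX → ℝ) :
    |h.fn a x| ≤ R := by
  simpa [FirstStage.fn] using abs_tensorForm_le hh.1 (abs_φA_le hh a) (abs_φX_le hh x) zero_le_one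

lemma continuous_fn (hh : h ∈ firstStageClass N R DA DX d₁ d₂) :
    Continuous fun z : (Fin DA → ℝ) × (Fin DX → ℝ) => h.fn z.1 z.2 := by
  have h1 : ∀ i, Continuous fun a => h.φA a i := fun i => continuous_of_mem_rampNetClass (hh.2.1 i)
  have h2 := continuous_φX hh
  unfold FirstStage.fn tensorForm
  fun_prop

end FirstStage

namespace BackdoorModel

variable {Ω : Type*} [MeasurableSpace Ω] {DA DX d₁ d₂ : ℕ} {R : ℝ} (M : BackdoorModel Ω DA DX R)

/-! ### High-probability events -/

/-- The range of one observation. -/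
def obsRange : Set ((Fin DA → ℝ) × (Fin DX → ℝ) × ℝ) := M.𝒜 ×ˢ M.𝒳 ×ˢ Set.Icc (-R) R

lemma measurableSet_obsRange : MeasurableSet M.obsRange :=
  M.measurableSet_𝒜.prod (M.measurableSet_𝒳.prod measurableSet_Icc)

lemma obs_mem_obsRange (ω : Ω) : (M.A ω, M.X ω, M.Y ω) ∈ M.obsRange :=
  ⟨M.A_mem ω, M.X_mem ω, abs_le.1 (M.abs_Y_le ω)⟩

lemma measurable_obs : Measurable fun ω => (M.A ω, M.X ω, M.Y ω) :=
  M.measurable_A.prodMk (M.measurable_X.prodMk M.measurable_Y)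

instance : IsProbabilityMeasure M.law :=
  Measure.isProbabilityMeasure_map M.measurable_obs.aemeasurable

instance (n : ℕ) : IsProbabilityMeasure (M.sampleLaw n) := by
  unfold sampleLaw
  infer_instance

lemma ofReal_le_sampleLaw_inter {n : ℕ} {E E' : Set (Fin n → (Fin DA → ℝ) × (Fin DX → ℝ) × ℝ)}
    {δ : ℝ} (hE : MeasurableSet E) (hE' : MeasurableSet E')
    (h : (M.sampleLaw n).real Eᶜ ≤ 2 * δ) (h' : (M.sampleLaw n).real E'ᶜ ≤ 2 * δ) :
    ENNReal.ofReal (1 - 4 * δ) ≤ M.sampleLaw n (E ∩ E') := by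
  refine ENNReal.ofReal_le_of_le_toReal ?_
  have h1 := probReal_compl_eq_one_sub (μ := M.sampleLaw n) (hE.inter hE')
  rw [Set.compl_inter] at h1
  have h2 := measureReal_union_le (μ := M.sampleLaw n) Eᶜ E'ᶜ
  change 1 - 4 * δ ≤ (M.sampleLaw n).real (E ∩ E')
  linarith

lemma abs_sq_sub_sq_sub_le {y u v R : ℝ} (hy : |y| ≤ R) (hu : |u| ≤ R) (hv : |v| ≤ R) :
    |(y - u) ^ 2 - (y - v) ^ 2| ≤ 4 * R * |u - v| := by
  have e : (y - u) ^ 2 - (y - v) ^ 2 = (u + v - 2 * y) * (u - v) := by ring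
  rw [e, abs_mul]
  refine mul_le_mul_of_nonneg_right ?_ (abs_nonneg _)
  have h1 := abs_le.1 hy
  have h2 := abs_le.1 hu
  have h3 := abs_le.1 hv
  exact abs_le.2 ⟨by linarith, by linarith⟩

/-- With high probability, first-stage minimizers have squared `L²`-error of order `n^{-1/2}`. -/
theorem exists_first_stage_event (DA DX d₁ d₂ : ℕ) (N : NetParams) (R B : ℝ) {δ : ℝ}
    (hδ : 0 < δ) :
    ∃ T : ℝ, 0 ≤ T ∧ ∀ (Ω : Type u) [MeasurableSpace Ω] (M : BackdoorModel Ω DA DX R),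
      M.InputsBounded B → ∀ h₀ ∈ firstStageClass N R DA DX d₁ d₂,
      (∀ a ∈ M.𝒜, ∀ x ∈ M.𝒳, h₀.fn a x = M.g a x) → ∀ n : ℕ, 1 ≤ n →
      ∃ E : Set (Fin n → (Fin DA → ℝ) × (Fin DX → ℝ) × ℝ), MeasurableSet E ∧
        (M.sampleLaw n).real Eᶜ ≤ δ ∧ ∀ S ∈ E, (∀ i, S i ∈ M.obsRange) ∧
          ∀ h : FirstStage DA DX d₁ d₂, IsERM₁ N R S h →
            M.l2AX (fun a x => h.fn a x - h₀.fn a x) ≤ √(T / √n) := by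
  rcases lt_or_ge R 0 with hR | hR
  · exact ⟨0, le_rfl, fun Ω _ M => absurd M.R_nonneg (not_le.2 hR)⟩
  obtain ⟨C, hC, hrad⟩ := firstStageClass_rademacherAbsLE N hR DA DX d₁ d₂ B
  refine ⟨2 * (4 * R * C + 1) / δ, by positivity, fun Ω _ M hB h₀ hh₀ hg n hn => ?_⟩
  let G : firstStageClass N R DA DX d₁ d₂ → (Fin DA → ℝ) × (Fin DX → ℝ) × ℝ → ℝ :=
    fun h z => (z.2.2 - h.1.fn z.1 z.2.1) ^ 2 - (z.2.2 - h₀.fn z.1 z.2.1) ^ 2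
  have hfc : ∀ h ∈ firstStageClass N R DA DX d₁ d₂,
      Continuous fun z : (Fin DA → ℝ) × (Fin DX → ℝ) × ℝ => h.fn z.1 z.2.1 := fun h hh =>
    (continuous_fn hh).comp (continuous_fst.prodMk (continuous_fst.comp continuous_snd))
  have hGc : ∀ h, Continuous (G h) := fun h => by
    have h1 := hfc h.1 h.2
    have h2 := hfc h₀ hh₀
    fun_prop
  -- The `h₀` terms cancel in increments, leaving a difference of squares with Lipschitz constant `4
  -- * R` on values bounded by `R`.
  have hGd : ∀ h h', ∀ z ∈ M.obsRange,
      |G h z - G h' z| ≤ 4 * R * |h.1.fn z.1 z.2.1 - h'.1.fn z.1 z.2.1| := fun h h' z hz => by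
    simp only [G, sub_sub_sub_cancel_right]
    exact abs_sq_sub_sq_sub_le (abs_le.2 hz.2.2) (abs_fn_le h.2 _ _) (abs_fn_le h'.2 _ _)
  have hG0 : ∀ z, G ⟨h₀, hh₀⟩ z = 0 := fun z => sub_self _
  -- The `+ 1` in `K` only makes it positive.
  obtain ⟨E, hE, hEδ, hES⟩ := exists_uniform_deviation_event M.μ M.measurable_obs
    M.measurableSet_obsRange M.obs_mem_obsRange (G := G) (fun h => (hGc h).measurable)
    (M := 4 * R * (2 * R)) (K := 4 * R * C + 1)
    (fun h z hz => by
      have h1 := hGd h ⟨h₀, hh₀⟩ z hz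
      rw [hG0, sub_zero] at h1
      refine h1.trans (mul_le_mul_of_nonneg_left ?_ (by positivity))
      exact (abs_sub _ _).trans (by linarith [abs_fn_le h.2 z.1 z.2.1, abs_fn_le hh₀ z.1 z.2.1]))
    (sepOn_of_continuous hGc (t := Metric.closedBall 0 B ×ˢ Metric.closedBall 0 B ×ˢ Set.Icc (-R) R)
      ((isCompact_closedBall _ _).prod ((isCompact_closedBall _ _).prod isCompact_Icc))
      fun z hz => ⟨by simpa using hB.1 _ hz.1, by simpa using hB.2 _ hz.2.1, hz.2.2⟩)
    (fun _ => ⟨⟨h₀, hh₀⟩, fun z _ => hG0 z⟩) hn (by positivity)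
    (fun S hS => by
      have h1 := ((hrad n (fun i => ((S i).1, (S i).2.1)) (fun i => hB.1 _ (hS i).1)
        fun i => hB.2 _ (hS i).2.1).toLE.const_mul (c := 4 * R) (by positivity)).compare
        (u := fun h i => G h (S i)) fun i h h' => by
          rw [← mul_sub, abs_mul, abs_of_nonneg (by positivity : 0 ≤ 4 * R)]
          exact hGd h h' _ (hS i)
      refine h1.mono ?_
      nlinarith [Real.sqrt_nonneg (n : ℝ)]) hδ
  refine ⟨E, hE, hEδ, fun S hS => ⟨(hES S hS).1, fun h hh => Real.sqrt_le_sqrt ?_⟩⟩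
  have h1 := (hES S hS).2 ⟨h, hh.1⟩
  have hmeas : ∀ h ∈ firstStageClass N R DA DX d₁ d₂,
      Measurable (Function.uncurry h.fn) := fun h hh => (continuous_fn hh).measurable
  have h2 := M.integral_excess_first (hmeas h hh.1) (hmeas h₀ hh₀)
    (fun a _ x _ => abs_fn_le hh.1 a x) (fun a _ x _ => abs_fn_le hh₀ a x) hg
  have h3 : 1 / (n : ℝ) * ∑ i, G ⟨h, hh.1⟩ (S i) ≤ 0 := by
    have := hh.2 h₀ hh₀
    simp only [G, Finset.sum_sub_distrib, mul_sub]
    simp only [loss₁] at this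
    linarith
  simp only [G] at h1 h3
  rw [← h2]
  linarith

/-- With high probability, empirical means of a fixed feature map are accurate. -/
theorem exists_mean_event {N : NetParams} {n : ℕ} (hn : 1 ≤ n) {δ : ℝ} (hδ : 0 < δ)
    {h₀ : FirstStage DA DX d₁ d₂} (hh₀ : h₀ ∈ firstStageClass N R DA DX d₁ d₂) :
    ∃ E : Set (Fin n → (Fin DA → ℝ) × (Fin DX → ℝ) × ℝ), MeasurableSet E ∧
      (M.sampleLaw n).real Eᶜ ≤ δ ∧ ∀ S ∈ E, ∀ j,
        |∫ ω, h₀.φX (M.X ω) j ∂M.μ - 1 / (n : ℝ) * ∑ i, h₀.φX (S i).2.1 j| ≤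
          2 * (3 * d₂ + 1) / δ / √n := by
  -- The signs `±1` give a two-sided bound from one-sided deviations, and the sign `0` supplies the
  -- zero member; the `3` in the bound counts the signs.
  let G : Fin d₂ × SignType → (Fin DA → ℝ) × (Fin DX → ℝ) × ℝ → ℝ :=
    fun k z => (k.2 : ℝ) * h₀.φX z.2.1 k.1
  have hb : ∀ k z, |G k z| ≤ 1 := fun k z => by
    have h1 := abs_φX_le hh₀ z.2.1 k.1
    simp only [G]
    rcases k with ⟨j, s⟩
    cases s <;> simp [h1]
  obtain ⟨E, hE, hEδ, hES⟩ := exists_uniform_deviation_event M.μ M.measurable_obs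
    M.measurableSet_obsRange M.obs_mem_obsRange (G := G) (M := 1) (K := 3 * d₂ + 1)
    (fun k => ((continuous_φX hh₀ k.1).measurable.comp
      (measurable_fst.comp measurable_snd)).const_mul _)
    (fun k z _ => hb k z)
    ⟨Set.univ, Set.countable_univ, fun k ε hε => ⟨k, Set.mem_univ k, fun z _ => by simp [hε.le]⟩⟩
    (fun k => ⟨(k.1, 0), fun z _ => by simp [G]⟩) hn (by positivity)
    (fun S _ => by
      refine (RademacherAbsLE.of_finite zero_le_one (fun k i => G k (S i))
        fun k i => hb k _).toLE.mono ?_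
      have : Fintype.card SignType = 3 := rfl
      rw [Fintype.card_prod, this, Fintype.card_fin]
      push_cast
      nlinarith [Real.sqrt_nonneg (n : ℝ)]) hδ
  refine ⟨E, hE, hEδ, fun S hS j => abs_le.2 ⟨?_, ?_⟩⟩
  · have h1 := (hES S hS).2 (j, -1)
    simp only [G, SignType.coe_neg, SignType.coe_one, neg_mul, one_mul, integral_neg,
      Finset.sum_neg_distrib, mul_neg] at h1
    linarith
  · have h1 := (hES S hS).2 (j, 1)
    simpa only [G, SignType.coe_one, one_mul] using h1

/-! ### The second stage: separability and excess risk. -/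

/-- The sup-norm condition makes the second-stage class separable in the sup norm on `𝒜`. -/
lemma sepOn_of_supNormCondition₂ {Hf : Set ((Fin DA → ℝ) → ℝ)} {c' β' : ℝ} (hc' : 0 < c')
    (hβ' : 0 < β') (hHf : M.IsSecondStageClass Hf) (hsup : M.SupNormCondition₂ Hf d₂ c' β')
    (hd : 0 < d₂) : SepOn (fun (f : Hf) => f.1) M.𝒜 := by
  set ν := M.μ.map M.A with hν
  have hp : IsProbabilityMeasure ν := Measure.isProbabilityMeasure_map M.measurable_A.aemeasurable
  have hbound : ∀ f : Hf, ∀ᵐ a ∂ν, ‖f.1 a‖ ≤ 1 := fun f => by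
    have h𝒜 : ∀ᵐ a ∂ν, a ∈ M.𝒜 :=
      (ae_map_iff (p := fun a => a ∈ M.𝒜) M.measurable_A.aemeasurable M.measurableSet_𝒜).2
        (Filter.Eventually.of_forall M.A_mem)
    filter_upwards [h𝒜] with a ha using (hHf f f.2).2 a ha
  have hmem : ∀ f : Hf, MemLp f.1 2 ν := fun f =>
    MemLp.of_bound (hHf f f.2).1.aestronglyMeasurable 1 (hbound f)
  have hdist : ∀ f f' : Hf, dist ((hmem f).toLp f.1) ((hmem f').toLp f'.1) =
      M.l2A (fun a => f.1 a - f'.1 a) := fun f f' => by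
    rw [dist_edist, Lp.edist_toLp_toLp, ((hmem f).sub (hmem f')).eLpNorm_eq_integral_rpow_norm
      two_ne_zero ENNReal.ofNat_ne_top, ENNReal.toReal_ofReal (by positivity), l2A,
      Real.sqrt_eq_rpow]
    have hm : Measurable fun a => (f.1 a - f'.1 a) ^ 2 :=
      ((hHf f f.2).1.sub (hHf f' f'.2).1).pow_const 2
    have := integral_map (μ := M.μ) M.measurable_A.aemeasurable
      (f := fun a => (f.1 a - f'.1 a) ^ 2) hm.aestronglyMeasurable
    rw [← this, ← hν]
    norm_num
  have : Fact ((1 : ℝ≥0∞) ≤ 2) := ⟨one_le_two⟩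
  have : Fact ((2 : ℝ≥0∞) ≠ ⊤) := ⟨ENNReal.ofNat_ne_top⟩
  -- `L²` of the law of `A` is separable; the sup-norm condition upgrades `L²`-density to uniform
  -- density on `𝒜`.
  obtain ⟨D, hD, h⟩ := exists_countable_dense_index fun f : Hf => (hmem f).toLp f.1
  refine ⟨D, hD, fun f ε hε => ?_⟩
  -- This tolerance is the one that the sup-norm condition converts into `ε`.
  obtain ⟨d, hd', hfd⟩ := h f ((c' * ε) ^ β') (by positivity)
  refine ⟨d, hd', fun a ha => ?_⟩
  rw [hdist] at hfd
  have : Nonempty (Fin d₂) := ⟨⟨0, hd⟩⟩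
  have h1 := hsup (fun _ => f.1) (fun _ => d.1) (fun _ => f.2) (fun _ => d.2) a ha ⟨0, hd⟩
  rw [ciSup_const] at h1
  refine h1.trans ?_
  have h2 : M.l2A (fun a => f.1 a - d.1 a) ^ (1 / β') ≤ c' * ε := by
    refine (Real.rpow_le_rpow (Real.sqrt_nonneg _) hfd.le (by positivity)).trans_eq ?_
    rw [← Real.rpow_mul (by positivity), mul_one_div_cancel hβ'.ne', Real.rpow_one]
  rw [one_div, inv_mul_le_iff₀ hc']
  exact h2

/-- With high probability, second-stage minimizers have squared `L²`-error of order `n^{-1/2}`,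
uniformly over the feature maps. -/
theorem exists_second_stage_event (DA DX d₂ : ℕ) (N : NetParams) (R B K : ℝ) {c' β' δ : ℝ}
    (hc' : 0 < c') (hβ' : 0 < β') (hδ : 0 < δ) :
    ∃ T : ℝ, 0 ≤ T ∧ ∀ (Ω : Type u) [MeasurableSpace Ω] (M : BackdoorModel Ω DA DX R),
      M.InputsBounded B → ∀ Hf : Set ((Fin DA → ℝ) → ℝ), M.IsSecondStageClass Hf →
      (∀ n : ℕ, 1 ≤ n → ∀ s : Fin n → Fin DA → ℝ, (∀ i, s i ∈ M.𝒜) →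
        RademacherLE (fun (f : Hf) i => f.1 (s i)) (K * √n)) →
      M.SupNormCondition₂ Hf d₂ c' β' → ∀ n : ℕ, 1 ≤ n →
      ∃ E : Set (Fin n → (Fin DA → ℝ) × (Fin DX → ℝ) × ℝ), MeasurableSet E ∧
        (M.sampleLaw n).real Eᶜ ≤ δ ∧ ∀ S ∈ E, ∀ φ ∈ featureClass N DX d₂,
          ∀ f f₀ : Fin d₂ → (Fin DA → ℝ) → ℝ, IsERM₂ Hf S φ f → (∀ j, f₀ j ∈ Hf) →
          (∀ a ∈ M.𝒜, ∀ j, f₀ j a = ∫ x, φ x j ∂(M.condX a)) →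
          ∀ j, M.l2A (fun a => f j a - f₀ j a) ≤ √(T / √n) := by
  obtain ⟨C, hC, hrad⟩ := rampNetClass_rademacherAbsLE N DX B
  -- Two squared losses, each `4`-Lipschitz in the residual, give the `8`; the `+ 1` ensures
  -- positivity.
  set K' := 8 * (C + |K|) + 1 with hK'
  have hK'0 : 0 < K' := by positivity
  refine ⟨d₂ * (2 * K' / δ), by positivity, fun Ω _ M hB Hf hHf hradf hsup n hn => ?_⟩
  -- Without coordinates the sup-norm condition is vacuous and gives no separability, but there is
  -- nothing to prove.
  rcases Nat.eq_zero_or_pos d₂ with rfl | hd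
  · exact ⟨Set.univ, MeasurableSet.univ, by simp [hδ.le], fun S _ φ _ f f₀ _ _ _ j => j.elim0⟩
  -- The index includes the feature and its target `f₀`, since both depend on the sample through the
  -- learned feature map.
  let G : rampNetClass N DX × Hf × Hf → (Fin DA → ℝ) × (Fin DX → ℝ) × ℝ → ℝ :=
    fun k z => (k.1.1 z.2.1 - k.2.1.1 z.1) ^ 2 - (k.1.1 z.2.1 - k.2.2.1 z.1) ^ 2
  have bφ : ∀ (φ : rampNetClass N DX) x, |φ.1 x| ≤ 1 := fun φ =>
    abs_le_one_of_mem_rampNetClass φ.2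
  have bf : ∀ (f : Hf), ∀ a ∈ M.𝒜, |f.1 a| ≤ 1 := fun f => (hHf f f.2).2
  have key : ∀ x y : ℝ, |x| ≤ 2 → |y| ≤ 2 → |x ^ 2 - y ^ 2| ≤ 4 * |x - y| := fun x y hx hy => by
    rw [sq_sub_sq, abs_mul]
    exact mul_le_mul_of_nonneg_right ((abs_add_le _ _).trans (by linarith)) (abs_nonneg _)
  have bd : ∀ (φ : rampNetClass N DX) (f : Hf), ∀ z ∈ M.obsRange, |φ.1 z.2.1 - f.1 z.1| ≤ 2 :=
    fun φ f z hz => (abs_sub _ _).trans (by linarith [bφ φ z.2.1, bf f _ hz.1])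
  have hsφ : SepOn (fun φ : rampNetClass N DX => φ.1) M.𝒳 :=
    sepOn_of_continuous (fun φ => continuous_of_mem_rampNetClass φ.2)
      (isCompact_closedBall 0 B) fun x hx => by simpa using hB.2 x hx
  have hsf := M.sepOn_of_supNormCondition₂ hc' hβ' hHf hsup hd
  have hsep : SepOn G M.obsRange := by
    obtain ⟨D₁, hD₁, h₁⟩ := hsφ
    obtain ⟨D₂, hD₂, h₂⟩ := hsf
    refine ⟨D₁ ×ˢ D₂ ×ˢ D₂, hD₁.prod (hD₂.prod hD₂), fun k ε hε => ?_⟩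
    -- `16` accounts for the Lipschitz constant `4`, two perturbed arguments and two squares.
    obtain ⟨φ, hφ, e₁⟩ := h₁ k.1 (ε / 16) (by positivity)
    obtain ⟨f, hf, e₂⟩ := h₂ k.2.1 (ε / 16) (by positivity)
    obtain ⟨f', hf', e₃⟩ := h₂ k.2.2 (ε / 16) (by positivity)
    refine ⟨(φ, f, f'), ⟨hφ, hf, hf'⟩, fun z hz => ?_⟩
    have q : ∀ g g' : Hf, |g.1 z.1 - g'.1 z.1| ≤ ε / 16 →
        |(k.1.1 z.2.1 - g.1 z.1) ^ 2 - (φ.1 z.2.1 - g'.1 z.1) ^ 2| ≤ ε / 2 := fun g g' hg => by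
      refine (key _ _ (bd _ _ z hz) (bd _ _ z hz)).trans ?_
      rw [sub_sub_sub_comm]
      linarith [abs_sub (k.1.1 z.2.1 - φ.1 z.2.1) (g.1 z.1 - g'.1 z.1), e₁ _ hz.2.1]
    have r := q _ _ (e₂ _ hz.1)
    have r' := q _ _ (e₃ _ hz.1)
    simp only [G]
    rw [sub_sub_sub_comm]
    exact (abs_sub _ _).trans (by linarith)
  have hrad' : ∀ S : Fin n → (Fin DA → ℝ) × (Fin DX → ℝ) × ℝ, (∀ i, S i ∈ M.obsRange) →
      RademacherLE (fun k i => G k (S i)) (K' * √n) := fun S hS => by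
    have h1 := (hrad n (fun i => (S i).2.1) fun i => hB.2 _ (hS i).2.1).toLE
    have h2 := (hradf n hn (fun i => (S i).1) fun i => (hS i).1).neg
    have h3 := (h1.reindex (Prod.fst : rampNetClass N DX × Hf → _)).add
      (h2.reindex (Prod.snd : rampNetClass N DX × Hf → _))
    have h4 : RademacherLE (fun (k : rampNetClass N DX × Hf) i =>
        (k.1.1 (S i).2.1 - k.2.1 (S i).1) ^ 2) (4 * (C * √n + K * √n)) := by
      refine (h3.const_mul (c := 4) (by norm_num)).compare fun i k l => ?_
      rw [← mul_sub, abs_mul, abs_of_nonneg (by norm_num : (0 : ℝ) ≤ 4), ← sub_eq_add_neg,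
        ← sub_eq_add_neg]
      exact key _ _ (bd _ _ _ (hS i)) (bd _ _ _ (hS i))
    have h5 := (h4.reindex fun k : rampNetClass N DX × Hf × Hf => (k.1, k.2.1)).add
      (h4.neg.reindex fun k : rampNetClass N DX × Hf × Hf => (k.1, k.2.2))
    simp only [← sub_eq_add_neg] at h5
    refine h5.mono ?_
    have := Real.sqrt_nonneg (n : ℝ)
    nlinarith [le_abs_self K]
  obtain ⟨E, hE, hEδ, hES⟩ := exists_uniform_deviation_event M.μ M.measurable_obs
    M.measurableSet_obsRange M.obs_mem_obsRange (G := G) (M := 16) (K := K')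
    (fun k => by
      have h1 := (continuous_of_mem_rampNetClass k.1.2).measurable
      have h2 := (hHf _ k.2.1.2).1
      have h3 := (hHf _ k.2.2.2).1
      fun_prop)
    (fun k z hz => by
      refine (key _ _ (bd _ _ z hz) (bd _ _ z hz)).trans ?_
      linarith [abs_sub (k.1.1 z.2.1 - k.2.1.1 z.1) (k.1.1 z.2.1 - k.2.2.1 z.1),
        bd k.1 k.2.1 z hz, bd k.1 k.2.2 z hz])
    hsep (fun k => ⟨(k.1, k.2.1, k.2.1), fun z _ => sub_self _⟩) hn hK'0 hrad' hδ
  refine ⟨E, hE, hEδ, fun S hS φ hφ f f₀ hf hf₀ hcond j => Real.sqrt_le_sqrt ?_⟩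
  have h1 : ∀ j, ∫ ω, (f j (M.A ω) - f₀ j (M.A ω)) ^ 2 ∂M.μ ≤ 2 * K' / δ / √n +
      (1 / (n : ℝ) * ∑ i, (φ (S i).2.1 j - f j (S i).1) ^ 2 -
        1 / (n : ℝ) * ∑ i, (φ (S i).2.1 j - f₀ j (S i).1) ^ 2) := fun j => by
    have h2 := (hES S hS).2 (⟨fun x => φ x j, hφ j⟩, ⟨f j, hf.1 j⟩, ⟨f₀ j, hf₀ j⟩)
    have h3 := M.integral_excess_second (continuous_of_mem_rampNetClass (hφ j)).measurable
      (hHf _ (hf.1 j)).1 (hHf _ (hf₀ j)).1 (abs_le_one_of_mem_rampNetClass (hφ j))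
      (hHf _ (hf.1 j)).2 (hHf _ (hf₀ j)).2 fun a ha => hcond a ha j
    rw [← h3]
    simp only [G, Finset.sum_sub_distrib] at h2
    linarith
  have h4 : loss₂ S φ f ≤ loss₂ S φ f₀ := hf.2 f₀ hf₀
  have h5 : ∀ f : Fin d₂ → (Fin DA → ℝ) → ℝ, loss₂ S φ f =
      ∑ j, 1 / (n : ℝ) * ∑ i, (φ (S i).2.1 j - f j (S i).1) ^ 2 := fun f => by
    rw [loss₂, Finset.sum_comm, Finset.mul_sum]
  rw [h5, h5] at h4
  -- The minimizer controls only the sum over coordinates of the empirical excess risks. Since the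
  -- population excess risks are nonnegative, each is at most their sum, which costs the factor
  -- `d₂`.
  calc ∫ ω, (f j (M.A ω) - f₀ j (M.A ω)) ^ 2 ∂M.μ
      ≤ ∑ j, ∫ ω, (f j (M.A ω) - f₀ j (M.A ω)) ^ 2 ∂M.μ :=
        Finset.single_le_sum (f := fun j => ∫ ω, (f j (M.A ω) - f₀ j (M.A ω)) ^ 2 ∂M.μ)
          (fun j _ => integral_nonneg fun ω => sq_nonneg _) (Finset.mem_univ j)
    _ ≤ ∑ j, (2 * K' / δ / √n +
      (1 / (n : ℝ) * ∑ i, (φ (S i).2.1 j - f j (S i).1) ^ 2 -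
        1 / (n : ℝ) * ∑ i, (φ (S i).2.1 j - f₀ j (S i).1) ^ 2)) :=
        Finset.sum_le_sum fun j _ => h1 j
    _ ≤ d₂ * (2 * K' / δ) / √n := by
        rw [Finset.sum_add_distrib, Finset.sum_sub_distrib, Finset.sum_const, Finset.card_univ,
          Fintype.card_fin, nsmul_eq_mul, mul_div_assoc (d₂ : ℝ)]
        linarith

end BackdoorModel

/-! ### From `L²`-errors to uniform errors -/

lemma rpow_sqrt_div_sqrt {T β : ℝ} (hT : 0 ≤ T) {n : ℕ} :
    √(T / √n) ^ (1 / β) = √T ^ (1 / β) * (n : ℝ) ^ (-(1 / (4 * β))) := by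
  have hn : (0 : ℝ) ≤ n := n.cast_nonneg
  rw [Real.sqrt_div hT, Real.div_rpow (Real.sqrt_nonneg _) (Real.sqrt_nonneg _),
    Real.sqrt_eq_rpow (√(n : ℝ)), Real.sqrt_eq_rpow (n : ℝ), ← Real.rpow_mul hn,
    ← Real.rpow_mul hn, Real.rpow_neg hn, div_eq_mul_inv]
  congr 3
  ring

lemma RademacherLE.of_hasRademacherRate {Z : Type*} {𝓗 : Set (Z → ℝ)} {𝒵 : Set Z} {K : ℝ}
    (h : HasRademacherRate 𝓗 𝒵 K) (hb : ∀ f ∈ 𝓗, ∀ z ∈ 𝒵, |f z| ≤ 1) {n : ℕ} (hn : 1 ≤ n)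
    {s : Fin n → Z} (hs : ∀ i, s i ∈ 𝒵) :
    RademacherLE (fun (f : 𝓗) i => f.1 (s i)) (K * √n) := by
  have hn0 : (0 : ℝ) < n := by exact_mod_cast hn
  refine ⟨fun σ => n * ⨆ f : 𝓗, 1 / (n : ℝ) * ∑ i, ((σ i : ℤ) : ℝ) * f.1 (s i),
    fun σ f => ?_, ?_⟩
  -- The supremum in `empRademacher` is a majorant only when the range is bounded, which the bound
  -- `1` on the class guarantees.
  · have hbdd : BddAbove (Set.range fun f : 𝓗 =>
        1 / (n : ℝ) * ∑ i, ((σ i : ℤ) : ℝ) * f.1 (s i)) := by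
      refine ⟨1 / (n : ℝ) * ∑ _i : Fin n, 1, ?_⟩
      rintro _ ⟨g, rfl⟩
      refine mul_le_mul_of_nonneg_left (Finset.sum_le_sum fun i _ => ?_) (by positivity)
      refine (le_abs_self _).trans ?_
      rw [abs_mul, abs_sgn, one_mul]
      exact hb g g.2 _ (hs i)
    have h1 := mul_le_mul_of_nonneg_left (le_ciSup hbdd f) hn0.le
    rwa [← mul_assoc, mul_one_div_cancel hn0.ne', one_mul] at h1
  · rw [← Finset.mul_sum]
    have h1 := h n hn s hs
    rw [empRademacher, one_div, inv_mul_le_iff₀ (by positivity)] at h1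
    refine (mul_le_mul_of_nonneg_left h1 hn0.le).trans_eq ?_
    have h0 : √(n : ℝ) ≠ 0 := (Real.sqrt_pos.2 hn0).ne'
    field_simp
    rw [Real.sq_sqrt hn0.le, mul_comm]

namespace BackdoorModel

variable {Ω : Type*} [MeasurableSpace Ω] {DA DX d₁ d₂ : ℕ} {R : ℝ} (M : BackdoorModel Ω DA DX R)

/-- If the exponent in the sup-norm condition is larger than one, then the first-stage class
vanishes on `𝒜 × 𝒳`, by scaling of the weights. -/
lemma fn_eq_zero_of_supNormCondition {N : NetParams} {c β : ℝ} (hβ : 0 < β) (hβ1 : β < 1)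
    (hsup : M.SupNormCondition N d₁ d₂ c β) {h : FirstStage DA DX d₁ d₂}
    (hh : h ∈ firstStageClass N R DA DX d₁ d₂) {a : Fin DA → ℝ} (ha : a ∈ M.𝒜)
    {x : Fin DX → ℝ} (hx : x ∈ M.𝒳) : h.fn a x = 0 := by
  let k : ℝ → FirstStage DA DX d₁ d₂ := fun t => ⟨fun i j => t * h.w i j, h.φA, h.φX⟩
  have hkfn : ∀ t a x, (k t).fn a x = t * h.fn a x := fun t a x => by
    simp [k, FirstStage.fn, tensorForm, Finset.mul_sum, mul_assoc]
  have hk : ∀ t, 0 ≤ t → t ≤ 1 → k t ∈ firstStageClass N R DA DX d₁ d₂ := fun t h0 h1 => by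
    refine ⟨?_, hh.2⟩
    simp only [k, abs_mul, abs_of_nonneg h0, ← Finset.mul_sum]
    exact (mul_le_of_le_one_left (Finset.sum_nonneg fun i _ => Finset.sum_nonneg fun j _ =>
      abs_nonneg _) h1).trans hh.1
  set l := M.l2AX h.fn
  have hl : 0 ≤ l := Real.sqrt_nonneg _
  have hβ' : 0 < 1 / β - 1 := by
    rw [sub_pos, lt_div_iff₀ hβ, one_mul]
    exact hβ1
  -- Scaling the weights by `t` scales the left side of the sup-norm condition by `t` and the right
  -- side by `t ^ (1 / β)`. Dividing by `t` leaves a positive power, which tends to zero.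
  have key : ∀ t : ℝ, 0 < t → t ≤ 1 → |h.fn a x| ≤ 1 / c * l ^ (1 / β) * t ^ (1 / β - 1) := by
    intro t h0 h1
    have h2 := hsup (k t) (hk t h0.le h1) (k 0) (hk 0 le_rfl zero_le_one) a ha x hx
    simp only [hkfn, zero_mul, sub_zero] at h2
    have h3 : M.l2AX (fun a x => t * h.fn a x) = t * l := by
      simp only [l2AX, l, mul_pow, integral_const_mul]
      rw [Real.sqrt_mul (sq_nonneg t), Real.sqrt_sq h0.le]
    rw [h3, abs_mul, abs_of_pos h0, Real.mul_rpow h0.le hl] at h2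
    rw [Real.rpow_sub h0, Real.rpow_one, ← mul_div_assoc, le_div_iff₀ h0]
    linarith
  have hlim : Filter.Tendsto (fun t : ℝ => 1 / c * l ^ (1 / β) * t ^ (1 / β - 1))
      (nhdsWithin 0 (Set.Ioi 0)) (nhds 0) := by
    have h1 := (Real.continuous_rpow_const hβ'.le).tendsto 0
    rw [Real.zero_rpow hβ'.ne'] at h1
    simpa using (h1.mono_left nhdsWithin_le_nhds).const_mul (1 / c * l ^ (1 / β))
  have h4 : |h.fn a x| ≤ 0 := by
    refine ge_of_tendsto hlim ?_
    filter_upwards [Ioc_mem_nhdsGT (zero_lt_one' ℝ)] with t ht using key t ht.1 ht.2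
  exact abs_nonpos_iff.1 h4

lemma ateHat_eq_average {n : ℕ} (S : Fin n → (Fin DA → ℝ) × (Fin DX → ℝ) × ℝ)
    (h : FirstStage DA DX d₁ d₂) (a : Fin DA → ℝ) :
    ateHat S h a = 1 / (n : ℝ) * ∑ i, h.fn a (S i).2.1 :=
  tensorForm_average _ _ (fun i => h.φX (S i).2.1) _

lemma abs_average_le {n : ℕ} (hn : 1 ≤ n) {u : Fin n → ℝ} {ε : ℝ} (h : ∀ i, |u i| ≤ ε) :
    |1 / (n : ℝ) * ∑ i, u i| ≤ ε := by
  have hn0 : (0 : ℝ) < n := by exact_mod_cast hn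
  rw [abs_mul, abs_of_pos (by positivity), one_div, inv_mul_le_iff₀ hn0]
  refine (Finset.abs_sum_le_sum_abs _ _).trans ((Finset.sum_le_sum fun i _ => h i).trans_eq ?_)
  simp

lemma abs_fn_sub_le {N : NetParams} {c β T : ℝ} (hc : 0 < c) (hβ : 0 < β) (hT : 0 ≤ T)
    (hsup : M.SupNormCondition N d₁ d₂ c β) {h h₀ : FirstStage DA DX d₁ d₂}
    (hh : h ∈ firstStageClass N R DA DX d₁ d₂) (hh₀ : h₀ ∈ firstStageClass N R DA DX d₁ d₂)
    {n : ℕ} (hl : M.l2AX (fun a x => h.fn a x - h₀.fn a x) ≤ √(T / √n))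
    {a : Fin DA → ℝ} (ha : a ∈ M.𝒜) {x : Fin DX → ℝ} (hx : x ∈ M.𝒳) :
    |h₀.fn a x - h.fn a x| ≤ 1 / c * √T ^ (1 / β) * (n : ℝ) ^ (-(1 / (4 * β))) := by
  rw [abs_sub_comm, mul_assoc, ← rpow_sqrt_div_sqrt hT]
  exact (hsup h hh h₀ hh₀ a ha x hx).trans (mul_le_mul_of_nonneg_left
    (Real.rpow_le_rpow (Real.sqrt_nonneg _) hl (by positivity)) (by positivity))

/-! ### Error rates for the two estimators. -/

/-- The uniform rate for the average treatment effect. -/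
theorem exists_ateBound (DA DX d₁ d₂ : ℕ) (N : NetParams) (R B : ℝ) {c β δ : ℝ}
    (hc : 0 < c) (hβ : 0 < β) (hδ : 0 < δ) :
    ∃ C : ℝ, ∀ (Ω : Type u) [MeasurableSpace Ω] (M : BackdoorModel Ω DA DX R),
      M.InputsBounded B → M.WellSpecified N d₁ d₂ → M.SupNormCondition N d₁ d₂ c β →
      ∀ n : ℕ, 1 ≤ n → M.ATEBound N d₁ d₂ n δ (C * (n : ℝ) ^ (-(1 / (4 * β)))) := by
  -- Two events are used, each allowed to fail with probability `2 * δ`.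
  have h2δ : 0 < 2 * δ := by positivity
  obtain ⟨T, hT, hfirst⟩ := exists_first_stage_event.{u} DA DX d₁ d₂ N R B h2δ
  set T' : ℝ := 2 * (3 * d₂ + 1) / (2 * δ) with hT'
  have hT'0 : 0 ≤ T' := by positivity
  refine ⟨1 / c * √T ^ (1 / β) + |R| * T', fun Ω _ M hB ⟨h₀, hh₀, hg⟩ hsup n hn => ?_⟩
  have hn0 : (0 : ℝ) < n := by exact_mod_cast hn
  have hn1 : (1 : ℝ) ≤ n := by exact_mod_cast hn
  obtain ⟨E, hE, hEδ, hES⟩ := hfirst Ω M hB h₀ hh₀ hg n hn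
  obtain ⟨E', hE', hEδ', hES'⟩ := M.exists_mean_event hn h2δ hh₀
  refine ⟨E ∩ E', hE.inter hE', M.ofReal_le_sampleLaw_inter hE hE' hEδ hEδ', ?_⟩
  rintro S ⟨hS, hS'⟩ h hh a ha
  have hrange := (hES S hS).1
  have hate : M.ate a = ∫ ω, h₀.fn a (M.X ω) ∂M.μ := by
    rw [M.ate_eq ha]
    exact integral_congr_ae (Filter.Eventually.of_forall fun ω => (hg a ha _ (M.X_mem ω)).symm)
  -- For small `β` the claimed rate would beat the `n^{-1/2}` error of empirical means, but for `β <
  -- 1` the class vanishes and both quantities are zero. For `β ≥ 1` the averaging error is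
  -- dominated.
  rcases lt_or_ge β 1 with hβ1 | hβ1
  · have h1 : M.ate a = 0 := by
      rw [hate]
      simp [M.fn_eq_zero_of_supNormCondition hβ hβ1 hsup hh₀ ha (M.X_mem _)]
    have h2 : ateHat S h a = 0 := by
      rw [ateHat_eq_average]
      simp [M.fn_eq_zero_of_supNormCondition hβ hβ1 hsup hh.1 ha (hrange _).2.1]
    rw [h1, h2, sub_zero, abs_zero]
    positivity
  -- Averaging the true `h₀` over the sample involves a feature map that is not data-dependent, so
  -- concentration of `d₂` fixed means is enough.
  · have h1 : |M.ate a - ateHat S h₀ a| ≤ R * (T' / √n) := by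
      have e : M.ate a = tensorForm h₀.w (h₀.φA a) (fun j => ∫ ω, h₀.φX (M.X ω) j ∂M.μ) := by
        rw [hate]
        exact integral_tensorForm _ _ fun j => integrable_of_measurable_of_abs_le
          ((continuous_φX hh₀ j).measurable.comp M.measurable_X) fun ω => abs_φX_le hh₀ _ j
      rw [e, ateHat, tensorForm_sub]
      exact abs_tensorForm_le hh₀.1 (abs_φA_le hh₀ a) (hES' S hS') (by positivity)
    have h2 : |ateHat S h₀ a - ateHat S h a| ≤
        1 / c * √T ^ (1 / β) * (n : ℝ) ^ (-(1 / (4 * β))) := by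
      rw [ateHat_eq_average, ateHat_eq_average, ← mul_sub, ← Finset.sum_sub_distrib]
      exact abs_average_le hn fun i =>
        M.abs_fn_sub_le hc hβ hT hsup hh.1 hh₀ ((hES S hS).2 h hh) ha (hrange i).2.1
    have h3 : T' / √n ≤ T' * (n : ℝ) ^ (-(1 / (4 * β))) := by
      rw [div_eq_mul_inv, Real.sqrt_eq_rpow, ← Real.rpow_neg hn0.le]
      refine mul_le_mul_of_nonneg_left (Real.rpow_le_rpow_of_exponent_le hn1 ?_) hT'0
      rw [neg_le_neg_iff, div_le_div_iff₀ (by positivity) two_pos]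
      linarith
    have h4 := mul_le_mul_of_nonneg_left h3 M.R_nonneg
    rw [abs_of_nonneg M.R_nonneg]
    calc |M.ate a - ateHat S h a| ≤ |M.ate a - ateHat S h₀ a| + |ateHat S h₀ a - ateHat S h a| :=
          abs_sub_le _ _ _
      _ ≤ _ := by linarith

/-- The uniform rate for the average treatment effect on the treated. -/
theorem exists_attBound (DA DX d₁ d₂ : ℕ) (N : NetParams) (R B K : ℝ) {c β c' β' δ : ℝ}
    (hc : 0 < c) (hβ : 0 < β) (hc' : 0 < c') (hβ' : 0 < β') (hδ : 0 < δ) :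
    ∃ C : ℝ, ∀ (Ω : Type u) [MeasurableSpace Ω] (M : BackdoorModel Ω DA DX R),
      M.InputsBounded B → M.WellSpecified N d₁ d₂ → M.SupNormCondition N d₁ d₂ c β →
      ∀ Hf : Set ((Fin DA → ℝ) → ℝ), M.IsSecondStageClass Hf →
      (∀ n : ℕ, 1 ≤ n → ∀ s : Fin n → Fin DA → ℝ, (∀ i, s i ∈ M.𝒜) →
        RademacherLE (fun (f : Hf) i => f.1 (s i)) (K * √n)) →
      M.SupNormCondition₂ Hf d₂ c' β' → ∀ n : ℕ, 1 ≤ n → M.ATTBound N Hf d₁ d₂ n δ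
        (C * ((n : ℝ) ^ (-(1 / (4 * β))) + (n : ℝ) ^ (-(1 / (4 * β'))))) := by
  have h2δ : 0 < 2 * δ := by positivity
  obtain ⟨T, hT, hfirst⟩ := exists_first_stage_event.{u} DA DX d₁ d₂ N R B h2δ
  obtain ⟨T', hT', hsecond⟩ := exists_second_stage_event.{u} DA DX d₂ N R B K hc' hβ' h2δ
  refine ⟨1 / c * √T ^ (1 / β) + |R| * (1 / c' * √T' ^ (1 / β')),
    fun Ω _ M hB ⟨h₀, hh₀, hg⟩ hsup Hf hHf hrad hsup₂ n hn => ?_⟩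
  obtain ⟨E, hE, hEδ, hES⟩ := hfirst Ω M hB h₀ hh₀ hg n hn
  obtain ⟨E', hE', hEδ', hES'⟩ := hsecond Ω M hB Hf hHf hrad hsup₂ n hn
  refine ⟨E ∩ E', hE.inter hE', M.ofReal_le_sampleLaw_inter hE hE' hEδ hEδ', ?_⟩
  rintro S ⟨hS, hS'⟩ h hh ⟨f₀, hf₀, hcond⟩ f hf a ha a' ha'
  have hl := hES' S hS' h.φX hh.1.2.2 f f₀ hf hf₀ hcond
  set r := (n : ℝ) ^ (-(1 / (4 * β)))
  set r' := (n : ℝ) ^ (-(1 / (4 * β')))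
  have hr : 0 ≤ r := by positivity
  have hr' : 0 ≤ r' := by positivity
  have hφi : ∀ j, Integrable (fun x => h.φX x j) (M.condX a') := fun j =>
    integrable_of_measurable_of_abs_le (continuous_φX hh.1 j).measurable
      fun x => abs_φX_le hh.1 x j
  have hfi : ∀ h ∈ firstStageClass N R DA DX d₁ d₂, Integrable (fun x => h.fn a x) (M.condX a') :=
    fun h hh => integrable_of_measurable_of_abs_le
      ((continuous_fn hh).comp (Continuous.prodMk_right a)).measurable fun x => abs_fn_le hh a x
  -- By bilinearity, conditioning acts on the features alone, so the conditional mean of the learned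
  -- regression function is expressed through the embedding `f₀`.
  have e1 : ∫ x, h.fn a x ∂(M.condX a') = tensorForm h.w (h.φA a) (fun j => f₀ j a') := by
    simp_rw [hcond a' ha']
    exact integral_tensorForm _ _ hφi
  have e2 : M.att a a' = ∫ x, h₀.fn a x ∂(M.condX a') := by
    rw [M.att_eq ha ha']
    refine integral_congr_ae ?_
    filter_upwards [M.condX_mem a' ha'] with x hx using (hg a ha x hx).symm
  have h1 : |M.att a a' - ∫ x, h.fn a x ∂(M.condX a')| ≤ 1 / c * √T ^ (1 / β) * r := by
    rw [e2, ← integral_sub (hfi h₀ hh₀) (hfi h hh.1)]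
    have := norm_integral_le_of_norm_le_const (μ := M.condX a')
      (f := fun x => h₀.fn a x - h.fn a x) (C := 1 / c * √T ^ (1 / β) * r) (by
        filter_upwards [M.condX_mem a' ha'] with x hx
        exact M.abs_fn_sub_le hc hβ hT hsup hh.1 hh₀ ((hES S hS).2 h hh) ha hx)
    simpa using this
  have h2 : ∀ j, |f₀ j a' - f j a'| ≤ 1 / c' * √T' ^ (1 / β') * r' := fun j => by
    have : Nonempty (Fin d₂) := ⟨j⟩
    rw [abs_sub_comm, mul_assoc, ← rpow_sqrt_div_sqrt hT']
    refine (hsup₂ f f₀ hf.1 hf₀ a' ha' j).trans (mul_le_mul_of_nonneg_left ?_ (by positivity))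
    exact Real.rpow_le_rpow (Real.iSup_nonneg fun j => Real.sqrt_nonneg _) (ciSup_le hl)
      (by positivity)
  have h3 : |∫ x, h.fn a x ∂(M.condX a') - attHat h f a a'| ≤
      R * (1 / c' * √T' ^ (1 / β') * r') := by
    rw [e1, attHat, tensorForm_sub]
    exact abs_tensorForm_le hh.1.1 (abs_φA_le hh.1 a) h2 (by positivity)
  rw [abs_of_nonneg M.R_nonneg]
  -- The mixed terms are nonnegative, so one constant can multiply the sum of the two rates.
  have h4 : 0 ≤ 1 / c * √T ^ (1 / β) * r' := by positivity
  have h5 : 0 ≤ R * (1 / c' * √T' ^ (1 / β')) * r := by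
    have := M.R_nonneg
    positivity
  calc |M.att a a' - attHat h f a a'| ≤ |M.att a a' - ∫ x, h.fn a x ∂(M.condX a')| +
        |∫ x, h.fn a x ∂(M.condX a') - attHat h f a a'| := abs_sub_le _ _ _
    _ ≤ _ := by linarith

end BackdoorModel

theorem mainTheorem1 (DA DX d₁ d₂ : ℕ) (N : NetParams) (R B c β δ : ℝ)
    (hc : 0 < c) (hβ : 0 < β) (hδ : 0 < δ) :
    -- ATE
    (∃ C : ℝ, ∀ (Ω : Type u) [MeasurableSpace Ω] (M : BackdoorModel Ω DA DX R),
      M.InputsBounded B → M.WellSpecified N d₁ d₂ → M.SupNormCondition N d₁ d₂ c β →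
      ∀ n : ℕ, 1 ≤ n → M.ATEBound N d₁ d₂ n δ (C * (n : ℝ) ^ (-(1 / (4 * β))))) ∧
    -- ATT, second-stage class with Rademacher complexity of order `n^{-1/2}`
    (∀ K c' β' : ℝ, 0 < c' → 0 < β' →
      ∃ C : ℝ, ∀ (Ω : Type u) [MeasurableSpace Ω] (M : BackdoorModel Ω DA DX R),
      M.InputsBounded B → M.WellSpecified N d₁ d₂ → M.SupNormCondition N d₁ d₂ c β →
      ∀ Hf : Set ((Fin DA → ℝ) → ℝ), M.IsSecondStageClass Hf →
      HasRademacherRate Hf M.𝒜 K → M.SupNormCondition₂ Hf d₂ c' β' →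
      ∀ n : ℕ, 1 ≤ n → M.ATTBound N Hf d₁ d₂ n δ
        (C * ((n : ℝ) ^ (-(1 / (4 * β))) + (n : ℝ) ^ (-(1 / (4 * β')))))) ∧
    -- ATT, second-stage class of norm-bounded (possibly truncated) ReLU networks
    (∀ (N' : NetParams) (c' β' : ℝ), 0 < c' → 0 < β' →
      ∃ C : ℝ, ∀ (Ω : Type u) [MeasurableSpace Ω] (M : BackdoorModel Ω DA DX R),
      M.InputsBounded B → M.WellSpecified N d₁ d₂ → M.SupNormCondition N d₁ d₂ c β →
      ∀ Hf : Set ((Fin DA → ℝ) → ℝ), M.IsSecondStageClass Hf →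
      (Hf ⊆ netClass N' DA ∨ Hf ⊆ rampNetClass N' DA) → M.SupNormCondition₂ Hf d₂ c' β' →
      ∀ n : ℕ, 1 ≤ n → M.ATTBound N Hf d₁ d₂ n δ
        (C * ((n : ℝ) ^ (-(1 / (4 * β))) + (n : ℝ) ^ (-(1 / (4 * β')))))) := by
  refine ⟨BackdoorModel.exists_ateBound DA DX d₁ d₂ N R B hc hβ hδ, fun K c' β' hc' hβ' => ?_,
    fun N' c' β' hc' hβ' => ?_⟩
  · obtain ⟨C, hC⟩ := BackdoorModel.exists_attBound.{u} DA DX d₁ d₂ N R B K hc hβ hc' hβ' hδ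
    exact ⟨C, fun Ω _ M hB hw hsup Hf hHf hrate => hC Ω M hB hw hsup Hf hHf fun n hn s hs =>
      RademacherLE.of_hasRademacherRate hrate (fun f hf => (hHf f hf).2) hn hs⟩
  -- The sum `K₁ + K₂` serves both alternatives, so the constant does not depend on which one holds;
  -- Rademacher bounds pass to subclasses.
  · obtain ⟨K₁, hK₁, h₁⟩ := netClass_rademacherAbsLE N' DA B
    obtain ⟨K₂, hK₂, h₂⟩ := rampNetClass_rademacherAbsLE N' DA B
    obtain ⟨C, hC⟩ :=
      BackdoorModel.exists_attBound.{u} DA DX d₁ d₂ N R B (K₁ + K₂) hc hβ hc' hβ' hδ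
    refine ⟨C, fun Ω _ M hB hw hsup Hf hHf hsub => hC Ω M hB hw hsup Hf hHf fun n _ s hs => ?_⟩
    have hn0 := Real.sqrt_nonneg (n : ℝ)
    have hs' : ∀ i, ‖s i‖ ≤ B := fun i => hB.1 _ (hs i)
    rcases hsub with hsub | hsub
    · exact ((h₁ n s hs').toLE.reindex fun f : Hf => ⟨f.1, hsub f.2⟩).mono (by nlinarith)
    · exact ((h₂ n s hs').toLE.reindex fun f : Hf => ⟨f.1, hsub f.2⟩).mono (by nlinarith)
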